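/- Consider a sequence of problems, indexed by $k\to\infty$, with sample size $n=n_k\to\infty$, number of trials $d=d_k\ge 1$ and probabilities $p_1=p_{1,k}$, $p_2=p_{2,k}\in[0,1]$ such that $p_1\asymp p_2$ and $d^{-1}\ll p_1,p_2=o(1)$. Here $x\ll y$ (or $x=o(y)$) means that $x\le c_k y$ for some $c_k\to0$, and $x\asymp y$ means equality up to constant factors. Let $$I^*=-2d\log\big((1-p_1)^{1/2}(1-p_2)^{1/2}+(p_1p_2)^{1/2}\big)$$ be the Rényi-$1/2$ divergence between $\mathrm{Bin}(d,p_1)$ and $\mathrm{Bin}(d,p_2)$. For data $X=(X_1,\dots,X_n)$ let $X^{(-i)}$ be $X$ without its $i$-th entry. (K-means.) Let $z^*\in\{1,2\}^n$ be a fixed label vector with $\#\{j:z^*_j=1\}\asymp\#\{j:z^*_j=2\}$ and let $X_j\sim\mathrm{Bin}(d,p_{z^*_j})$ be independent. Let $\tilde z^{(-i)}$ be an output of K-means clustering with two clusters on $X^{(-i)}$, that is, a labelling which together with suitable centres $c_1,c_2\in\mathbb R$ minimises $\sum_{j\ne i}(X_j-c_{z_j})^2$ over all labellings and all centres. The names $1,2$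 of its clusters are chosen in accordance with $z^*$, that is, $\tilde z^{(-i)}$ is at most as far in Hamming distance from $(z^*_j)_{j\ne i}$ as the labelling with the two names exchanged. Put $$\tilde p_m^{(-i)}=\frac{\sum_{j\neq i}X_j\,\mathbb 1(\tilde z^{(-i)}_j=m)}{d\,\#\{j\ne i:\tilde z^{(-i)}_j=m\}},\qquad m=1,2.$$ There is an absolute constant $C>0$ such that for all $\gamma=\gamma_k>2$ (constant or varying with $k$) the following holds. If $$d(p_1-p_2)^2\ge C\gamma p_1,\qquad nd(p_1-p_2)^2\ge C\gamma,\qquad I^*\gg C\gamma\Big(\frac{p_1}{p_1-p_2}\Big)^2\Big(1+\frac1{np_1}\Big),$$ then there is a sequence of positive numbers $c_k\to0$ such that, for all large $k$, with probability at least $1-10^{-\gamma}$, for all outputs of K-means, $$\max_{i\in[n]}\Big(\big|\tilde p_1^{(-i)}-p_1\big|+\big|\tilde p_2^{(-i)}-p_2\big|\Big)\le c_k\frac{I^*}{d}.\qquad(*)$$ (Method of moments.) Let $X_1,\dots,X_n$ be i.i.d. from the mixture $\frac12\mathrm{Bin}(d,p_1)+\frac12\mathrm{Bin}(d,p_2)$,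 where $p_1\ge p_2$. Put $$\hat M_1^{(-i)}=\frac{1}{(n-1)d}\sum_{j\ne i}X_j,\qquad \hat M_2^{(-i)}=\frac1{(n-1)d(d-1)}\sum_{j\neq i}(X_j^2-X_j),$$ $$\tilde p_{1}^{(-i)}=\hat M_1^{(-i)}+\big(\hat M_2^{(-i)}-(\hat M_1^{(-i)})^2\big)^{1/2},\qquad \tilde p_{2}^{(-i)}=\hat M_1^{(-i)}-\big(\hat M_2^{(-i)}-(\hat M_1^{(-i)})^2\big)^{1/2}$$ (the square root of a negative number being read as $0$). If $$I^*\gg 1+\frac{p_1}{|p_1-p_2|}\sqrt{\frac{dp_1(dp_1+\log n)\log n}{n}},$$ then there is a sequence of positive numbers $c_k\to0$ such that, for all large $k$, $(*)$ holds with probability at least $1-14n^{-2}$. -/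

import Mathlib

open Filter MeasureTheory ProbabilityTheory Asymptotics
open scoped Topology

noncomputable section

namespace BinomialMixture

/-! Labels live in `Fin 2`; the label `0` stands for the first component and `1` for the second.
A parameter `p : Fin 2 → unitInterval` carries `p 0 = p₁` and `p 1 = p₂`. -/

/-- Law of independent `X_j ∼ Bin(d, p_{z_j})`, `j = 1, …, n`, for a fixed label vector `z`. -/
def fixedLabelLaw {n : ℕ} (d : ℕ) (p : Fin 2 → unitInterval) (z : Fin n → Fin 2) :
    Measure (Fin n → ℕ) :=
  Measure.pi fun j => binomial d (p (z j))

/-- The mixture `½ Bin(d, p₁) + ½ Bin(d, p₂)`. -/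
def mixture (d : ℕ) (p : Fin 2 → unitInterval) : Measure ℕ :=
  (2⁻¹ : ENNReal) • binomial d (p 0) + (2⁻¹ : ENNReal) • binomial d (p 1)

instance (d : ℕ) (p : Fin 2 → unitInterval) : IsProbabilityMeasure (mixture d p) :=
  ⟨by simp [mixture, ENNReal.inv_two_add_inv_two]⟩

/-- Law of an i.i.d. sample of size `n` from `½ Bin(d, p₁) + ½ Bin(d, p₂)`. -/
def mixtureLaw (n d : ℕ) (p : Fin 2 → unitInterval) : Measure (Fin n → ℕ) :=
  Measure.pi fun _ => mixture d p

/-- The Rényi-`1/2` divergence `I*` between `Bin(d, p₁)` and `Bin(d, p₂)`. -/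
def renyiHalf (d : ℕ) (p : Fin 2 → unitInterval) : ℝ :=
  -2 * d * Real.log (√(1 - (p 0 : ℝ)) * √(1 - (p 1 : ℝ)) + √((p 0 : ℝ) * (p 1 : ℝ)))

/-- The number of indices that carry the label `m`. -/
def labelCount {ι : Type*} [Fintype ι] (z : ι → Fin 2) (m : Fin 2) : ℕ :=
  (Finset.univ.filter fun j => z j = m).card

/-- The vector (of data or of labels) with its `i`-th entry deleted. -/
def leaveOut {n : ℕ} {α : Type*} (x : Fin n → α) (i : Fin n) : {j : Fin n // j ≠ i} → α :=
  fun j => x j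

/-- The K-means objective, with two clusters, at the labelling `z` and the centres `c`. -/
def kmeansCost {ι : Type*} [Fintype ι] (x : ι → ℕ) (z : ι → Fin 2) (c : Fin 2 → ℝ) : ℝ :=
  ∑ j, ((x j : ℝ) - c (z j)) ^ 2

/-- `z` is an output of K-means clustering with two clusters: together with suitable centres it
minimises the K-means objective over all labellings and all centres. -/
def IsKMeans {ι : Type*} [Fintype ι] (x : ι → ℕ) (z : ι → Fin 2) : Prop :=
  ∃ c : Fin 2 → ℝ, ∀ (z' : ι → Fin 2) (c' : Fin 2 → ℝ), kmeansCost x z c ≤ kmeansCost x z' c'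

/-- Among the two namings of its clusters, `z` carries the one closer in Hamming distance to
`zstar` (cluster names are only defined up to a permutation). -/
def IsAligned {ι : Type*} [Fintype ι] (z zstar : ι → Fin 2) : Prop :=
  hammingDist z zstar ≤ hammingDist (fun j => Equiv.swap (0 : Fin 2) 1 (z j)) zstar

/-- The probability of the component `m`, estimated from a labelling `z` of the data `x`. -/
def labelEstimate {ι : Type*} [Fintype ι] (d : ℕ) (x : ι → ℕ) (z : ι → Fin 2) (m : Fin 2) : ℝ :=
  (∑ j, if z j = m then (x j : ℝ) else 0) / (d * labelCount z m)

/-- First empirical moment `(1 / (N d)) ∑ X_j`, where `N` is the number of observations. -/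
def empMoment₁ {ι : Type*} [Fintype ι] (d : ℕ) (x : ι → ℕ) : ℝ :=
  (∑ j, (x j : ℝ)) / (Fintype.card ι * d)

/-- Second empirical moment `(1 / (N d (d - 1))) ∑ (X_j² - X_j)`. -/
def empMoment₂ {ι : Type*} [Fintype ι] (d : ℕ) (x : ι → ℕ) : ℝ :=
  (∑ j, ((x j : ℝ) ^ 2 - x j)) / (Fintype.card ι * d * ((d : ℝ) - 1))

/-- The method of moments estimates `M₁ ± (M₂ - M₁²)^{1/2}` of `p₁ ≥ p₂`. -/
def momEstimate {ι : Type*} [Fintype ι] (d : ℕ) (x : ι → ℕ) : Fin 2 → ℝ :=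
  ![empMoment₁ d x + √(empMoment₂ d x - empMoment₁ d x ^ 2),
    empMoment₁ d x - √(empMoment₂ d x - empMoment₁ d x ^ 2)]

/-- The loss `|q₁ - p₁| + |q₂ - p₂|` of an estimate `q` of `p`. -/
def estError (q : Fin 2 → ℝ) (p : Fin 2 → unitInterval) : ℝ :=
  |q 0 - p 0| + |q 1 - p 1|

/-- All leave-one-out K-means estimates (for every output of K-means on the data without its
`i`-th entry, its clusters named in accordance with `z`) have loss at most `r`. -/
def kmeansEvent {n : ℕ} (d : ℕ) (p : Fin 2 → unitInterval) (z : Fin n → Fin 2) (r : ℝ) :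
    Set (Fin n → ℕ) :=
  {x | ∀ (i : Fin n) (zt : {j : Fin n // j ≠ i} → Fin 2),
    IsKMeans (leaveOut x i) zt → IsAligned zt (leaveOut z i) →
      estError (labelEstimate d (leaveOut x i) zt) p ≤ r}

/-- All leave-one-out method of moments estimates have loss at most `r`. -/
def momEvent (n d : ℕ) (p : Fin 2 → unitInterval) (r : ℝ) : Set (Fin n → ℕ) :=
  {x | ∀ i : Fin n, estError (momEstimate d (leaveOut x i)) p ≤ r}

/-- The asymptotic regime: the sample size tends to infinity, `p₁ ≍ p₂`, and
`d⁻¹ ≪ p₁, p₂ = o(1)`. -/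
structure Regime (n d : ℕ → ℕ) (p : ℕ → Fin 2 → unitInterval) : Prop where
  sample_tendsto : Tendsto n atTop atTop
  d_pos : ∀ k, 0 < d k
  same_order : (fun k => (p k 0 : ℝ)) =Θ[atTop] fun k => (p k 1 : ℝ)
  inv_d_small : ∀ m, (fun k => (d k : ℝ)⁻¹) =o[atTop] fun k => (p k m : ℝ)
  p_small : ∀ m, Tendsto (fun k => (p k m : ℝ)) atTop (𝓝 0)

end BinomialMixture

end

namespace BinomialMixture

/-! K-means. Everything rests on the within-cluster variation `W = ∑ (X_j - d p_{z_j})²`. A squared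
centred binomial has mean at most `d p` but exponential moments controlled only up to parameters of
order `1/d`. Chernoff's bound therefore gives `W ≲ γ d (n p + 1)` outside probability `10^(-γ)`
(`fixedLabelLaw_real_sum_sq_ge_le`); the `1` is the source of the correction `1/(n p₁)`. Deleting an
entry only lowers `W`, so one event serves every `i`. The rest is deterministic
(`IsKMeans.centroid_close`): K-means costs at most `W`, hence fitted and true centres are close in
mean square. If `W` is small against (cluster size) × (distance of the true centres)², no estimated
cluster holds many points of both true clusters, and each centroid is within `O(√(W/n))` of its
target. With `A` the quantity assumed `o(I*)`, this error is of order `√(A I*)/d = √(A/I*) · I*/d`.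
Separation of the centres follows from `A = o(I*)` and `I* ≲ d p`.

Method of moments. With `ρ = √(log n / n)`, truncated Bernstein bounds put both empirical moments
within relative error `O(ρ)`. Taking the square root divides the error by `p₁ - p₂`
(`abs_sqrt_sub_le`), so the loss is `O(ρ p₁²/(p₁ - p₂))`, which the assumption on `I*` makes
`o(I*/d)`. -/

/-! ### Exponential moments of binomial variables and of their squares -/

theorem integral_exp_mul_binomial (d : ℕ) (p : unitInterval) (s : ℝ) :
    ∫ x, Real.exp (s * (x : ℝ)) ∂binomial d p = (1 - p + p * Real.exp s) ^ d := by
  rw [integral_binomial, add_comm (1 - (p : ℝ)), add_pow, ← Nat.range_succ_eq_Iic]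
  refine Finset.sum_congr rfl fun k _ => ?_
  rw [mul_pow, ← Real.exp_nat_mul, smul_eq_mul, mul_comm s]
  ring

theorem integral_exp_mul_binomial_le (d : ℕ) (p : unitInterval) (s : ℝ) :
    ∫ x, Real.exp (s * (x : ℝ)) ∂binomial d p ≤ Real.exp (d * p * (Real.exp s - 1)) := by
  have hp0 := p.2.1
  have hp1 := p.2.2
  rw [integral_exp_mul_binomial, mul_assoc, Real.exp_nat_mul]
  refine pow_le_pow_left₀ (by have := Real.exp_pos s; nlinarith) ?_ _
  have := Real.add_one_le_exp ((p : ℝ) * (Real.exp s - 1))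
  linarith

/-- Factorising over the `d` trials lets Hoeffding's lemma be applied to a single variable in `[0,
1]`. -/
theorem integral_exp_mul_sub_binomial (d : ℕ) (p : unitInterval) (s : ℝ) :
    ∫ x, Real.exp (s * ((x : ℝ) - d * p)) ∂binomial d p =
      (∫ x, Real.exp (s * ((x : ℝ) - p)) ∂binomial 1 p) ^ d := by
  have h (e : ℕ) : ∫ x, Real.exp (s * ((x : ℝ) - e * p)) ∂binomial e p =
      Real.exp (-(s * p)) ^ e * (1 - p + p * Real.exp s) ^ e := by
    rw [← integral_exp_mul_binomial, ← integral_const_mul, ← Real.exp_nat_mul]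
    refine integral_congr_ae (.of_forall fun x => ?_)
    simp only [← Real.exp_add]
    ring_nf
  have h1 := h 1
  simp only [Nat.cast_one, one_mul, pow_one] at h1
  rw [h, h1, mul_pow]

theorem integral_binomial_one (p : unitInterval) :
    ∫ x, (x : ℝ) ∂binomial 1 p = p := by
  rw [integral_binomial, ← Nat.range_succ_eq_Iic]
  simp [Finset.sum_range_succ]

/-- Binomial variables are sub-Gaussian with variance proxy `d / 4`. -/
theorem integral_exp_mul_sub_binomial_le_hoeffding (d : ℕ) (p : unitInterval) (s : ℝ) :
    ∫ x, Real.exp (s * ((x : ℝ) - d * p)) ∂binomial d p ≤ Real.exp (d * (s ^ 2 / 8)) := by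
  rw [integral_exp_mul_sub_binomial, Real.exp_nat_mul]
  refine pow_le_pow_left₀ (integral_nonneg fun _ => (Real.exp_pos _).le) ?_ _
  have hb : ∀ᵐ x : ℕ ∂binomial 1 p, (x : ℝ) ∈ Set.Icc (0 : ℝ) 1 := by
    have := ae_le_of_hasLaw_binomial (n := 1) (p := p) (HasLaw.id (μ := binomial 1 p))
    filter_upwards [this] with x hx
    simp only [id] at hx
    exact ⟨by positivity, by exact_mod_cast hx⟩
  have := (hasSubgaussianMGF_of_mem_Icc (X := fun x : ℕ => (x : ℝ)) (μ := binomial 1 p)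
    (by fun_prop) hb).mgf_le s
  rw [integral_binomial_one] at this
  refine this.trans (le_of_eq ?_)
  norm_num
  ring

/-- Bernstein-type bound on the moment generating function of a centred binomial variable. -/
theorem integral_exp_mul_sub_binomial_le (d : ℕ) (p : unitInterval) {s : ℝ} (hs : |s| ≤ 1) :
    ∫ x, Real.exp (s * ((x : ℝ) - d * p)) ∂binomial d p ≤ Real.exp (d * p * s ^ 2) := by
  have hp0 := p.2.1
  have h1 : ∫ x, Real.exp (s * ((x : ℝ) - d * p)) ∂binomial d p =
      Real.exp (-(s * (d * p))) * ∫ x, Real.exp (s * (x : ℝ)) ∂binomial d p := by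
    rw [← integral_const_mul]
    refine integral_congr_ae (.of_forall fun x => ?_)
    simp only [← Real.exp_add]
    ring_nf
  rw [h1]
  refine (mul_le_mul_of_nonneg_left (integral_exp_mul_binomial_le d p s)
    (Real.exp_pos _).le).trans ?_
  rw [← Real.exp_add, Real.exp_le_exp]
  have h2 := (abs_le.1 (Real.abs_exp_sub_one_sub_id_le hs)).2
  have : (0 : ℝ) ≤ d * p := by positivity
  nlinarith

theorem pow_four_le_exp (y : ℝ) : y ^ 4 ≤ 24 * (Real.exp y + Real.exp (-y)) := by
  have h (y : ℝ) (hy : 0 ≤ y) : y ^ 4 ≤ 24 * Real.exp y := by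
    have := Real.pow_div_factorial_le_exp y hy 4
    norm_num [Nat.factorial] at this
    linarith
  rcases le_total 0 y with hy | hy
  · linarith [h y hy, Real.exp_pos (-y)]
  · have := h (-y) (by linarith)
    have e : (-y) ^ 4 = y ^ 4 := by ring
    linarith [Real.exp_pos y]

theorem integral_sub_pow_four_binomial_le (d : ℕ) (p : unitInterval) (h : 1 ≤ (d : ℝ) * p) :
    ∫ x, ((x : ℝ) - d * p) ^ 4 ∂binomial d p ≤ 144 * ((d : ℝ) * p) ^ 2 := by
  set μ : ℝ := (d : ℝ) * p with hμ
  have hμ0 : 0 < μ := by linarith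
  -- At the scale of the standard deviation the Bernstein bound equals `e` in both directions, and
  -- `24 · 2e ≤ 144`. The hypothesis `1 ≤ μ` keeps `s ≤ 1`.
  set s : ℝ := (√μ)⁻¹ with hs
  have hsq : √μ ^ 2 = μ := Real.sq_sqrt hμ0.le
  have hr : 1 ≤ √μ := Real.one_le_sqrt.2 h
  have hs0 : 0 < s := by positivity
  have hs1 : |s| ≤ 1 := by rw [abs_of_pos hs0]; exact inv_le_one_of_one_le₀ hr
  have hs2 : μ * s ^ 2 = 1 := by rw [hs, inv_pow, hsq, mul_inv_cancel₀ hμ0.ne']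
  have key (x : ℕ) : ((x : ℝ) - μ) ^ 4 ≤
      24 * μ ^ 2 * (Real.exp (s * ((x : ℝ) - μ)) + Real.exp ((-s) * ((x : ℝ) - μ))) := by
    have := pow_four_le_exp (s * ((x : ℝ) - μ))
    have e : ((x : ℝ) - μ) ^ 4 = μ ^ 2 * (s * ((x : ℝ) - μ)) ^ 4 := by
      have : (μ * s ^ 2) ^ 2 * ((x : ℝ) - μ) ^ 4 = μ ^ 2 * (s * ((x : ℝ) - μ)) ^ 4 := by ring
      rw [← this, hs2]; ring
    rw [e, neg_mul]
    nlinarith [sq_nonneg μ]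
  refine (integral_mono (integrable_binomial _) (integrable_binomial _) key).trans ?_
  rw [integral_const_mul, integral_add (integrable_binomial _) (integrable_binomial _)]
  have h1 := integral_exp_mul_sub_binomial_le d p hs1
  have h2 := integral_exp_mul_sub_binomial_le d p (s := -s) (by rwa [abs_neg])
  rw [← hμ] at h1 h2
  rw [neg_sq] at h2
  rw [hs2] at h1 h2
  have := Real.exp_one_lt_d9
  nlinarith [sq_nonneg μ]

/-- Markov's inequality for exponentials of a real function on a discrete space. -/
theorem measureReal_ge_le_exp {Ω : Type*} [MeasurableSpace Ω] {μ : Measure Ω} [IsFiniteMeasure μ]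
    {g : Ω → ℝ} (hg : Integrable (fun x => Real.exp (g x)) μ) {a : ℝ}
    (h : ∫ x, Real.exp (g x) ∂μ ≤ Real.exp a) (b : ℝ) :
    μ.real {x | b ≤ g x} ≤ Real.exp (a - b) := by
  have := measure_ge_le_exp_mul_mgf (μ := μ) (X := g) (t := 1) b zero_le_one (by simpa using hg)
  simp only [neg_mul, one_mul, mgf] at this
  refine this.trans ?_
  rw [sub_eq_neg_add, Real.exp_add]
  exact mul_le_mul_of_nonneg_left h (Real.exp_pos _).le

theorem binomial_real_sq_ge_le {d : ℕ} (hd : 0 < d) (p : unitInterval) (m : ℕ) :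
    (binomial d p).real {x | (m : ℝ) ≤ ((x : ℝ) - d * p) ^ 2 / d} ≤
      2 * Real.exp (-2 * (m : ℝ)) := by
  have hd' : (0 : ℝ) < d := by exact_mod_cast hd
  set t : ℝ := √(m * d)
  have ht : t ^ 2 = m * d := Real.sq_sqrt (by positivity)
  have ht0 : 0 ≤ t := Real.sqrt_nonneg _
  have half (σ : ℝ) (hσ : σ ^ 2 = 1) :
      (binomial d p).real {x | t ≤ σ * ((x : ℝ) - d * p)} ≤ Real.exp (-2 * (m : ℝ)) := by
    -- The parameter `4t/d` minimises `d s²/8 - s t`; the minimum is `-2t²/d = -2m`.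
    have h := integral_exp_mul_sub_binomial_le_hoeffding d p (σ * (4 * t / d))
    have := measureReal_ge_le_exp (integrable_binomial _) h (4 * t / d * t)
    refine (measureReal_mono (fun x hx => ?_)).trans (this.trans (le_of_eq ?_))
    · have := mul_le_mul_of_nonneg_left (show t ≤ σ * ((x : ℝ) - d * p) from hx)
        (by positivity : 0 ≤ 4 * t / d)
      simp only [Set.mem_ofPred_eq]
      linarith
    · congr 1
      have : (σ * (4 * t / d)) ^ 2 = σ ^ 2 * 16 * t ^ 2 / d ^ 2 := by ring
      rw [this, hσ]
      field_simp
      rw [ht]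
      ring
  have hsub : {x : ℕ | (m : ℝ) ≤ ((x : ℝ) - d * p) ^ 2 / d} ⊆
      {x : ℕ | t ≤ 1 * ((x : ℝ) - d * p)} ∪ {x : ℕ | t ≤ (-1) * ((x : ℝ) - d * p)} := by
    intro x hx
    simp only [Set.mem_ofPred_eq, Set.mem_union, one_mul, neg_mul] at hx ⊢
    rw [le_div_iff₀ hd'] at hx
    exact le_abs.1 (Real.sqrt_le_iff.2 ⟨abs_nonneg _, by rwa [sq_abs]⟩)
  refine (measureReal_mono hsub).trans ((measureReal_union_le _ _).trans ?_)
  linarith [half 1 (by norm_num), half (-1) (by norm_num)]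

/-- Slice by the integer part `m` of the exponent: there the exponential is at most `e^(m+1)`,
against a tail `2e^(-2m)`. The geometric series sums to at most `2e/(1 - 1/e) < 9`. -/
theorem integral_exp_sq_div_binomial_le {d : ℕ} (hd : 0 < d) (p : unitInterval) :
    ∫ x, Real.exp (((x : ℝ) - d * p) ^ 2 / d) ∂binomial d p ≤ 9 := by
  have hd' : (0 : ℝ) < d := by exact_mod_cast hd
  have hp0 := p.2.1
  have hp1 := p.2.2
  set Y : ℕ → ℝ := fun x => ((x : ℝ) - d * p) ^ 2 / d with hY
  have hY0 (x : ℕ) : 0 ≤ Y x := by positivity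
  have hae : ∀ᵐ x ∂binomial d p, Real.exp (Y x) ≤
      ∑ m ∈ Finset.range (d + 1), Real.exp (m + 1) * Set.indicator {x | (m : ℝ) ≤ Y x} 1 x := by
    have := ae_le_of_hasLaw_binomial (n := d) (p := p) (HasLaw.id (μ := binomial d p))
    filter_upwards [this] with x hx
    have hx' : (x : ℝ) ≤ d := by exact_mod_cast hx
    have hYd : Y x ≤ d := by
      simp only [hY]
      rw [div_le_iff₀ hd', ← sq]
      have : (d : ℝ) * p ≤ d := mul_le_of_le_one_right hd'.le hp1
      have : 0 ≤ (d : ℝ) * p := by positivity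
      have : (0 : ℝ) ≤ x := by positivity
      exact sq_le_sq' (by linarith) (by linarith)
    have hfl : ⌊Y x⌋₊ ∈ Finset.range (d + 1) := by
      rw [Finset.mem_range, Nat.lt_succ_iff]
      exact Nat.floor_le_of_le hYd
    have hmem : x ∈ {x | ((⌊Y x⌋₊ : ℕ) : ℝ) ≤ Y x} := Nat.floor_le (hY0 x)
    refine le_trans ?_ (Finset.single_le_sum (f := fun m : ℕ =>
      Real.exp ((m : ℝ) + 1) * Set.indicator {x | (m : ℝ) ≤ Y x} 1 x) (fun m _ => ?_) hfl)
    · have : Set.indicator {y | ((⌊Y x⌋₊ : ℕ) : ℝ) ≤ Y y} (1 : ℕ → ℝ) x = 1 :=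
        Set.indicator_of_mem (s := {y | ((⌊Y x⌋₊ : ℕ) : ℝ) ≤ Y y}) (Nat.floor_le (hY0 x)) _
      simp only [this, mul_one]
      exact Real.exp_le_exp.2 (Nat.lt_floor_add_one _).le
    · exact mul_nonneg (Real.exp_pos _).le (Set.indicator_nonneg (fun _ _ => zero_le_one) _)
  refine (integral_mono_ae (integrable_binomial _) (integrable_binomial _) hae).trans ?_
  rw [integral_finsetSum _ fun _ _ => integrable_binomial _]
  have hterm (m : ℕ) : ∫ x, Real.exp ((m : ℝ) + 1) * Set.indicator {x | (m : ℝ) ≤ Y x} 1 x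
      ∂binomial d p ≤ 2 * Real.exp 1 * (Real.exp (-1)) ^ m := by
    rw [integral_const_mul, integral_indicator_one (.of_discrete)]
    have := mul_le_mul_of_nonneg_left (binomial_real_sq_ge_le hd p m) (Real.exp_pos (m + 1)).le
    refine this.trans (le_of_eq ?_)
    rw [← Real.exp_nat_mul, mul_left_comm, ← Real.exp_add, mul_assoc, ← Real.exp_add]
    ring_nf
  refine (Finset.sum_le_sum fun m _ => hterm m).trans ?_
  rw [← Finset.mul_sum]
  have he := Real.exp_one_lt_d9
  have he2 := Real.exp_one_gt_d9
  have hi : Real.exp (-1) ≤ 0.38 := by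
    rw [Real.exp_neg, inv_le_comm₀ (Real.exp_pos _) (by norm_num)]
    norm_num; linarith
  have hgeo := mul_neg_geom_sum (Real.exp (-1)) (d + 1)
  have hpow : 0 ≤ Real.exp (-1) ^ (d + 1) := by positivity
  have hS : 0 ≤ ∑ m ∈ Finset.range (d + 1), Real.exp (-1) ^ m := by positivity
  nlinarith

/-- The exponential moment of a squared centred binomial variable. -/
theorem integral_exp_mul_sq_binomial_le {d : ℕ} (hd : 0 < d) (p : unitInterval)
    (h : 1 ≤ (d : ℝ) * p) {l : ℝ} (hl0 : 0 ≤ l) (hl : l * (2 * d) ≤ 1) :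
    ∫ x, Real.exp (l * ((x : ℝ) - d * p) ^ 2) ∂binomial d p ≤ Real.exp (l * (80 * (d * p))) := by
  have hd' : (0 : ℝ) < d := by exact_mod_cast hd
  set μ : ℝ := (d : ℝ) * p with hμ
  have hμ0 : 0 < μ := by linarith
  have key (x : ℕ) : Real.exp (l * ((x : ℝ) - μ) ^ 2) ≤
      1 + (l * (2 * μ)⁻¹ * ((x : ℝ) - μ) ^ 4 + l * μ / 2 * Real.exp (((x : ℝ) - μ) ^ 2 / d)) := by
    set y : ℝ := (x : ℝ) - μ
    set e : ℝ := Real.exp (l * y ^ 2) with he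
    have he0 : 0 < e := Real.exp_pos _
    have h1 : e ≤ 1 + l * y ^ 2 * e := by
      have := Real.add_one_le_exp (-(l * y ^ 2))
      rw [Real.exp_neg, ← he] at this
      have := mul_le_mul_of_nonneg_right this he0.le
      rw [inv_mul_cancel₀ he0.ne'] at this
      linarith
    have h2 : e ^ 2 ≤ Real.exp (y ^ 2 / d) := by
      rw [he, ← Real.exp_nat_mul, Real.exp_le_exp, le_div_iff₀ hd']
      push_cast
      nlinarith [sq_nonneg y]
    -- AM-GM weighted by `μ`, so that both halves integrate to order `μ`: `72μ` from the fourth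
    -- moment and `9μ/2` from the exponential, together below `80μ`.
    have h3 : y ^ 2 * e ≤ (2 * μ)⁻¹ * y ^ 4 + μ / 2 * e ^ 2 := by
      have : 0 ≤ (2 * μ)⁻¹ * (y ^ 2 - μ * e) ^ 2 := by positivity
      have e2 : (2 * μ)⁻¹ * (y ^ 2 - μ * e) ^ 2 =
          (2 * μ)⁻¹ * y ^ 4 + μ / 2 * e ^ 2 - y ^ 2 * e := by
        field_simp
        ring
      linarith
    have h4 : μ / 2 * e ^ 2 ≤ μ / 2 * Real.exp (y ^ 2 / d) :=
      mul_le_mul_of_nonneg_left h2 (by positivity)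
    have := mul_le_mul_of_nonneg_left (h3.trans (add_le_add_right h4 _)) hl0
    linarith
  refine (integral_mono (integrable_binomial _) (integrable_binomial _) key).trans ?_
  rw [integral_add (integrable_binomial _) (integrable_binomial _),
    integral_add (integrable_binomial _) (integrable_binomial _), integral_const_mul,
    integral_const_mul]
  have h4 := integral_sub_pow_four_binomial_le d p h
  have h9 := integral_exp_sq_div_binomial_le hd p
  rw [← hμ] at h4 h9
  have h4' := mul_le_mul_of_nonneg_left h4 (by positivity : 0 ≤ l * (2 * μ)⁻¹)
  have h9' := mul_le_mul_of_nonneg_left h9 (by positivity : 0 ≤ l * μ / 2)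
  have e4 : l * (2 * μ)⁻¹ * (144 * μ ^ 2) = l * (72 * μ) := by field_simp; ring
  have := Real.add_one_le_exp (l * (80 * μ))
  have hlm : 0 ≤ l * μ := by positivity
  simp only [integral_const, probReal_univ, one_smul]
  linarith

/-! ### Concentration of the within-cluster variation -/

/-- The Chernoff bound for a sum of independent terms on a product space. -/
theorem pi_real_sum_ge_le {ι : Type*} [Fintype ι] (ν : ι → Measure ℕ)
    [∀ j, IsProbabilityMeasure (ν j)] (g : ι → ℕ → ℝ) (a : ι → ℝ)
    (hi : ∀ j, Integrable (fun x => Real.exp (g j x)) (ν j))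
    (h : ∀ j, ∫ x, Real.exp (g j x) ∂ν j ≤ Real.exp (a j)) (b : ℝ) :
    (Measure.pi ν).real {x | b ≤ ∑ j, g j (x j)} ≤ Real.exp (∑ j, a j - b) := by
  refine measureReal_ge_le_exp ?_ ?_ b
  · simp only [Real.exp_sum]
    exact Integrable.fintype_prod_dep hi
  · simp only [Real.exp_sum]
    rw [integral_fintype_prod_eq_prod (f := fun j x => Real.exp (g j x))]
    exact Finset.prod_le_prod (fun j _ => integral_nonneg fun _ => (Real.exp_pos _).le)
      fun j _ => h j

instance {n : ℕ} (d : ℕ) (p : Fin 2 → unitInterval) (z : Fin n → Fin 2) :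
    IsProbabilityMeasure (fixedLabelLaw d p z) := by
  unfold fixedLabelLaw; infer_instance

theorem fixedLabelLaw_real_sum_sq_ge_le {n d : ℕ} (hd : 0 < d) (p : Fin 2 → unitInterval)
    (z : Fin n → Fin 2) {P γ : ℝ} (hp : ∀ m, 1 ≤ (d : ℝ) * p m) (hP : ∀ m, (p m : ℝ) ≤ P)
    (hγ : 2 < γ) :
    (fixedLabelLaw d p z).real
      {x | 50 * γ * (d * (n * P + 1)) ≤ ∑ j, ((x j : ℝ) - d * p (z j)) ^ 2} ≤
      (10 : ℝ) ^ (-γ) := by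
  have hd' : (0 : ℝ) < d := by exact_mod_cast hd
  have hP0 : 0 ≤ P := (p 0).2.1.trans (hP 0)
  set s : ℝ := n * P + 1 with hs
  have hs1 : 1 ≤ s := by have : 0 ≤ (n : ℝ) * P := by positivity
                         linarith
  -- With this `l` the exponents add up to at most `40` and the threshold becomes `25γ`. Since `γ >
  -- 2`, `40 - 25γ ≤ -3γ ≤ -γ log 10`.
  set l : ℝ := (2 * d * s)⁻¹ with hl
  have hl0 : 0 < l := by positivity
  have hls : l * (2 * d * s) = 1 := inv_mul_cancel₀ (by positivity)
  have hl1 : l * (2 * d) ≤ 1 := by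
    have : l * (2 * d) ≤ l * (2 * d) * s := le_mul_of_one_le_right (by positivity) hs1
    linarith
  have hterm (j : Fin n) : ∫ x, Real.exp (l * ((x : ℝ) - d * p (z j)) ^ 2) ∂binomial d (p (z j)) ≤
      Real.exp (l * (80 * (d * P))) := by
    refine (integral_exp_mul_sq_binomial_le hd _ (hp _) hl0.le hl1).trans ?_
    rw [Real.exp_le_exp]
    have := hP (z j)
    gcongr
  have := pi_real_sum_ge_le (fun j => binomial d (p (z j)))
    (fun j x => l * ((x : ℝ) - d * p (z j)) ^ 2) (fun _ => l * (80 * (d * P)))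
    (fun j => integrable_binomial _) hterm (25 * γ)
  refine (measureReal_mono (fun x hx => ?_)).trans (this.trans ?_)
  · simp only [Set.mem_ofPred_eq] at hx ⊢
    rw [← Finset.mul_sum]
    have := mul_le_mul_of_nonneg_left hx hl0.le
    have e : l * (50 * γ * (d * s)) = 25 * γ * (l * (2 * d * s)) := by ring
    rw [e, hls] at this
    linarith
  · have h10 : (10 : ℝ) ≤ Real.exp 3 := by
      have h := Real.exp_one_gt_d9
      have : Real.exp 3 = Real.exp 1 ^ 3 := by rw [← Real.exp_nat_mul]; norm_num
      rw [this]
      have h2 : (2.7 : ℝ) ≤ Real.exp 1 := by linarith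
      exact le_trans (by norm_num) (pow_le_pow_left₀ (by norm_num) h2 3)
    have hlog : Real.log 10 ≤ 3 := (Real.log_le_iff_le_exp (by norm_num)).2 h10
    rw [Real.rpow_def_of_pos (by norm_num), Real.exp_le_exp]
    simp only [Finset.sum_const, Finset.card_univ, Fintype.card_fin, nsmul_eq_mul]
    have : (n : ℝ) * (l * (80 * (d * P))) = 40 * (l * (2 * d * s)) - 80 * l * d := by
      rw [hs]; ring
    rw [this, hls]
    have : 0 ≤ 80 * l * d := by positivity
    nlinarith

/-! ### Deterministic analysis of K-means -/

theorem card_mul_sq_mean_sub_le {α : Type*} {S : Finset α} (hS : 0 < (S.card : ℝ)) {x : α → ℝ} {c w : ℝ}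
    (h : ∑ j ∈ S, (x j - c) ^ 2 ≤ w) : S.card * ((∑ j ∈ S, x j) / S.card - c) ^ 2 ≤ w := by
  have hmean : (∑ j ∈ S, x j) / S.card - c = (∑ j ∈ S, (x j - c)) / S.card := by
    rw [Finset.sum_sub_distrib, Finset.sum_const, nsmul_eq_mul]
    field_simp
  have hcs : (∑ j ∈ S, (x j - c)) ^ 2 ≤ S.card * w :=
    sq_sum_le_card_mul_sum_sq.trans (mul_le_mul_of_nonneg_left h hS.le)
  rw [hmean, div_pow, ← mul_div_assoc, div_le_iff₀ (by positivity)]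
  nlinarith

section KMeans

variable {ι : Type*} [Fintype ι]

/-- The number of indices with label `a` in `z` and label `b` in `z'`. -/
def confusion (z z' : ι → Fin 2) (a b : Fin 2) : ℕ :=
  (Finset.univ.filter fun j => z j = a ∧ z' j = b).card

theorem labelCount_eq_confusion_left (z z' : ι → Fin 2) (a : Fin 2) :
    labelCount z a = confusion z z' a 0 + confusion z z' a 1 := by
  classical
  unfold labelCount confusion
  rw [← Finset.card_union_of_disjoint]
  · congr 1
    ext j
    simp only [Finset.mem_filter, Finset.mem_union, Finset.mem_univ, true_and]
    have : z' j = 0 ∨ z' j = 1 := by omega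
    tauto
  · rw [Finset.disjoint_left]
    intro j h1 h2
    simp only [Finset.mem_filter] at h1 h2
    omega

theorem labelCount_eq_confusion_right (z z' : ι → Fin 2) (b : Fin 2) :
    labelCount z' b = confusion z z' 0 b + confusion z z' 1 b := by
  rw [labelCount_eq_confusion_left z' z b]
  simp only [confusion, and_comm]

theorem sum_label_eq_confusion (z z' : ι → Fin 2) (f : Fin 2 → Fin 2 → ℝ) :
    ∑ j, f (z j) (z' j) = ∑ a, ∑ b, confusion z z' a b * f a b := by
  classical
  have h (j : ι) : f (z j) (z' j) = ∑ a, ∑ b, if z j = a ∧ z' j = b then f a b else 0 := by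
    rw [Finset.sum_eq_single (z j), Finset.sum_eq_single (z' j)] <;> simp +contextual [eq_comm]
  simp only [h]
  rw [Finset.sum_comm]
  refine Finset.sum_congr rfl fun a _ => ?_
  rw [Finset.sum_comm]
  refine Finset.sum_congr rfl fun b _ => ?_
  rw [← Finset.sum_filter, Finset.sum_const, nsmul_eq_mul, confusion]

theorem hammingDist_eq_confusion (z z' : ι → Fin 2) :
    hammingDist z' z = confusion z z' 0 1 + confusion z z' 1 0 := by
  classical
  unfold hammingDist confusion
  rw [← Finset.card_union_of_disjoint]
  · congr 1
    ext j
    simp only [Finset.mem_filter, Finset.mem_union, Finset.mem_univ, true_and]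
    omega
  · rw [Finset.disjoint_left]
    intro j h1 h2
    simp only [Finset.mem_filter] at h1 h2
    omega

theorem hammingDist_swap_eq_confusion (z z' : ι → Fin 2) :
    hammingDist (fun j => Equiv.swap (0 : Fin 2) 1 (z' j)) z =
      confusion z z' 0 0 + confusion z z' 1 1 := by
  rw [hammingDist_eq_confusion]
  have h (b c : Fin 2) : Equiv.swap (0 : Fin 2) 1 b = c ↔ b = Equiv.swap (0 : Fin 2) 1 c := by
    rw [Equiv.swap_apply_eq_iff]
  simp only [confusion, h, Equiv.swap_apply_left, Equiv.swap_apply_right]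

/-- One centre `c` cannot be near both `q` and `r`: `(q - r)² ≤ 2(c - q)² + 2(c - r)²`. -/
theorem mul_sq_sub_le_of_le {u v c q r w : ℝ}
    (h : u * (c - q) ^ 2 + v * (c - r) ^ 2 ≤ w) {t : ℝ} (hut : t ≤ u) (hvt : t ≤ v) (ht : 0 ≤ t) :
    t * (q - r) ^ 2 ≤ 2 * w := by
  have h1 : t * (c - q) ^ 2 ≤ u * (c - q) ^ 2 := by gcongr
  have h2 : t * (c - r) ^ 2 ≤ v * (c - r) ^ 2 := by gcongr
  nlinarith [mul_nonneg ht (sq_nonneg (c - q + (c - r)))]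

/-- If the data are close to two well separated points, according to the labels `z`, then so are
the centroids of every output of K-means. -/
theorem IsKMeans.centroid_close {x : ι → ℕ} {z zt : ι → Fin 2} (hk : IsKMeans x zt)
    (ha : IsAligned zt z) {q : Fin 2 → ℝ} {w N : ℝ} (hN : 0 < N)
    (hw : ∑ j, ((x j : ℝ) - q (z j)) ^ 2 ≤ w) (hcount : ∀ m, N ≤ labelCount z m)
    (hsep : 32 * w < N * (q 0 - q 1) ^ 2) (b : Fin 2) :
    0 < labelCount zt b ∧
      |(∑ j, if zt j = b then (x j : ℝ) else 0) / labelCount zt b - q b| ≤ 5 * √(w / N) := by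
  classical
  obtain ⟨c, hc⟩ := hk
  have hcw : ∑ j, ((x j : ℝ) - c (zt j)) ^ 2 ≤ w := (hc z q).trans hw
  have hw0 : 0 ≤ w := le_trans (Finset.sum_nonneg fun _ _ => sq_nonneg _) hw
  -- Passing through `x j` removes the data: what remains depends on the labels only, hence on the
  -- four entries of the confusion matrix.
  have h4 : ∑ j, (c (zt j) - q (z j)) ^ 2 ≤ 4 * w := by
    have : ∑ j, (c (zt j) - q (z j)) ^ 2 ≤
        ∑ j, (2 * ((x j : ℝ) - c (zt j)) ^ 2 + 2 * ((x j : ℝ) - q (z j)) ^ 2) := by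
      refine Finset.sum_le_sum fun j _ => ?_
      nlinarith [sq_nonneg (((x j : ℝ) - c (zt j)) + ((x j : ℝ) - q (z j)))]
    rw [Finset.sum_add_distrib, ← Finset.mul_sum, ← Finset.mul_sum] at this
    linarith
  rw [sum_label_eq_confusion z zt (fun a b => (c b - q a) ^ 2)] at h4
  simp only [Fin.sum_univ_two] at h4
  have hc0 := hcount 0
  have hc1 := hcount 1
  rw [labelCount_eq_confusion_left z zt] at hc0 hc1
  unfold IsAligned at ha
  rw [hammingDist_swap_eq_confusion, hammingDist_eq_confusion] at ha
  have ha' : (confusion z zt 0 1 : ℝ) + confusion z zt 1 0 ≤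
    confusion z zt 0 0 + confusion z zt 1 1 := by exact_mod_cast ha
  push_cast at hc0 hc1
  -- Two entries of at least `N/4` in one column would give `(N/4)(q 0 - q 1)² ≤ 8w`, which `hsep`
  -- excludes.
  have small (b : Fin 2)
      (h : confusion z zt 0 b * (c b - q 0) ^ 2 + confusion z zt 1 b * (c b - q 1) ^ 2 ≤ 4 * w) :
      (confusion z zt 0 b : ℝ) < N / 4 ∨ (confusion z zt 1 b : ℝ) < N / 4 := by
    by_contra! hcon
    have := mul_sq_sub_le_of_le h hcon.1 hcon.2 (by positivity)
    linarith
  have n00 : (0 : ℝ) ≤ confusion z zt 0 0 * (c 0 - q 0) ^ 2 := by positivity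
  have n01 : (0 : ℝ) ≤ confusion z zt 0 1 * (c 1 - q 0) ^ 2 := by positivity
  have n10 : (0 : ℝ) ≤ confusion z zt 1 0 * (c 0 - q 1) ^ 2 := by positivity
  have n11 : (0 : ℝ) ≤ confusion z zt 1 1 * (c 1 - q 1) ^ 2 := by positivity
  have hdiag : N / 2 ≤ confusion z zt b b := by
    have h0 := small 0 (by linarith)
    have h1 := small 1 (by linarith)
    -- Each column has an entry below `N/4`. Both in one row contradicts a row sum of at least `N`;
    -- both on the diagonal contradicts alignment. So they lie off the diagonal.
    have : N / 2 ≤ confusion z zt 0 0 ∧ N / 2 ≤ confusion z zt 1 1 := by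
      rcases h0 with h0 | h0 <;> rcases h1 with h1 | h1 <;> constructor <;> linarith
    fin_cases b
    · exact this.1
    · exact this.2
  have hle : (confusion z zt b b : ℝ) * (c b - q b) ^ 2 ≤ 4 * w := by
    fin_cases b
    · simp only [Fin.zero_eta]; linarith
    · simp only [Fin.mk_one]; linarith
  have hcb : N * (c b - q b) ^ 2 ≤ 8 * w := by
    nlinarith [mul_le_mul_of_nonneg_right hdiag (sq_nonneg (c b - q b))]
  have hmb : N / 2 ≤ (labelCount zt b : ℝ) := by
    refine hdiag.trans ?_
    rw [labelCount_eq_confusion_right z zt, Nat.cast_le]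
    fin_cases b
    · exact Nat.le_add_right _ _
    · exact Nat.le_add_left _ _
  have hM : (0 : ℝ) < labelCount zt b := by linarith
  refine ⟨by exact_mod_cast hM, ?_⟩
  rw [← Finset.sum_filter]
  set A : ℝ := (∑ j with zt j = b, (x j : ℝ)) / labelCount zt b with hA
  have hAc : N * (A - c b) ^ 2 ≤ 2 * w := by
    have h1 : (labelCount zt b : ℝ) * (A - c b) ^ 2 ≤ w := by
      refine card_mul_sq_mean_sub_le hM (le_trans ?_ hcw)
      have : ∑ j with zt j = b, ((x j : ℝ) - c b) ^ 2 =
          ∑ j with zt j = b, ((x j : ℝ) - c (zt j)) ^ 2 :=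
        Finset.sum_congr rfl fun j hj => by rw [(Finset.mem_filter.1 hj).2]
      rw [this]
      exact Finset.sum_le_sum_of_subset_of_nonneg (Finset.filter_subset _ _)
        fun _ _ _ => sq_nonneg _
    nlinarith [mul_le_mul_of_nonneg_right hmb (sq_nonneg (A - c b))]
  -- The bounds `2w/N` and `8w/N` combine to `2 · 2w/N + 2 · 8w/N = 20w/N`.
  have hfin : (A - q b) ^ 2 ≤ 25 * (w / N) := by
    rw [← mul_div_assoc, le_div_iff₀ hN]
    nlinarith [mul_nonneg hN.le (sq_nonneg ((A - c b) - (c b - q b)))]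
  have : 5 * √(w / N) = √(25 * (w / N)) := by
    rw [Real.sqrt_mul (by norm_num), show (25 : ℝ) = 5 ^ 2 by norm_num,
      Real.sqrt_sq (by norm_num)]
  rw [this]
  exact Real.abs_le_sqrt hfin

end KMeans

theorem labelCount_le_leaveOut {n : ℕ} (z : Fin n → Fin 2) (i : Fin n) (m : Fin 2) :
    labelCount z m ≤ labelCount (leaveOut z i) m + 1 := by
  classical
  have h : (Finset.univ.filter fun j => z j = m).erase i ⊆
      (Finset.univ.filter fun j : {j // j ≠ i} => leaveOut z i j = m).map
        (Function.Embedding.subtype _) := by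
    intro j hj
    simp only [Finset.mem_erase, Finset.mem_filter, Finset.mem_univ, true_and] at hj
    exact Finset.mem_map.2 ⟨⟨j, hj.1⟩, Finset.mem_filter.2 ⟨Finset.mem_univ _, hj.2⟩, rfl⟩
  have h1 := Finset.card_le_card h
  rw [Finset.card_map] at h1
  have h2 := Finset.pred_card_le_card_erase (s := Finset.univ.filter fun j => z j = m) (a := i)
  unfold labelCount
  omega

theorem sum_leaveOut {n : ℕ} (f : Fin n → ℝ) (i : Fin n) :
    ∑ j : {j : Fin n // j ≠ i}, f j = ∑ j, f j - f i := by
  classical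
  rw [eq_sub_iff_add_eq, ← Finset.sum_erase_add _ _ (Finset.mem_univ i)]
  congr 1
  exact (Finset.sum_subtype _ (by simp) f).symm

/-- Off the event that the data have a large within-cluster variation, all leave-one-out K-means
estimates are accurate. -/
theorem mem_kmeansEvent {n d : ℕ} (hd : 0 < d) {p : Fin 2 → unitInterval} {z : Fin n → Fin 2}
    {x : Fin n → ℕ} {w N r : ℝ} (hN : 0 < N)
    (hw : ∑ j, ((x j : ℝ) - d * p (z j)) ^ 2 ≤ w) (hcount : ∀ m, N + 1 ≤ labelCount z m)
    (hsep : 32 * w < N * (d * ((p 0 : ℝ) - p 1)) ^ 2) (hr : 10 * √(w / N) / d ≤ r) :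
    x ∈ kmeansEvent d p z r := by
  intro i zt hk ha
  have hd' : (0 : ℝ) < d := by exact_mod_cast hd
  have hw' : ∑ j, (((leaveOut x i j : ℕ) : ℝ) - d * p (leaveOut z i j)) ^ 2 ≤ w := by
    have := sum_leaveOut (fun j => ((x j : ℝ) - d * p (z j)) ^ 2) i
    simp only [leaveOut]
    rw [this]
    linarith [sq_nonneg ((x i : ℝ) - d * p (z i))]
  -- The spare `1` in `hcount` pays for the deleted index.
  have hc (m : Fin 2) : N ≤ labelCount (leaveOut z i) m := by
    have : (labelCount z m : ℝ) ≤ labelCount (leaveOut z i) m + 1 := by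
      exact_mod_cast labelCount_le_leaveOut z i m
    linarith [hcount m]
  have h := hk.centroid_close ha (q := fun m => d * p m) hN hw' hc
    (by rw [← mul_sub]; exact hsep)
  have h' (b : Fin 2) : |labelEstimate d (leaveOut x i) zt b - p b| ≤ 5 * √(w / N) / d := by
    obtain ⟨hpos, hb⟩ := h b
    have : labelEstimate d (leaveOut x i) zt b - p b =
        ((∑ j, if zt j = b then ((leaveOut x i j : ℕ) : ℝ) else 0) / labelCount zt b - d * p b) / d := by
      have : (0 : ℝ) < labelCount zt b := by exact_mod_cast hpos
      unfold labelEstimate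
      field_simp
    rw [this, abs_div, abs_of_pos hd']
    gcongr
  unfold estError
  have e : 10 * √(w / N) / d = 5 * √(w / N) / d + 5 * √(w / N) / d := by ring
  linarith [h' 0, h' 1]

/-! ### Comparison of the Rényi divergence with `d (p₁ - p₂)² / p₁` and with `d p₁` -/

/-- AM-GM on the first product; the second is completed to the square `(√p₁ - √p₂)²`. -/
theorem renyiHalf_arg_le_one (p : Fin 2 → unitInterval) :
    √(1 - (p 0 : ℝ)) * √(1 - (p 1 : ℝ)) + √((p 0 : ℝ) * (p 1 : ℝ)) ≤
      1 - (√(p 0 : ℝ) - √(p 1 : ℝ)) ^ 2 / 2 := by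
  have a0 := (p 0).2.1
  have a1 := (p 1).2.1
  have b0 := (p 0).2.2
  have b1 := (p 1).2.2
  rw [Real.sqrt_mul a0]
  have s0 := Real.sq_sqrt a0
  have s1 := Real.sq_sqrt a1
  have t0 := Real.sq_sqrt (sub_nonneg.2 b0)
  have t1 := Real.sq_sqrt (sub_nonneg.2 b1)
  nlinarith [sq_nonneg (√(1 - (p 0 : ℝ)) - √(1 - (p 1 : ℝ)))]

/-- From `-log B ≥ 1 - B` and `|p₁ - p₂| = |√p₁ - √p₂| (√p₁ + √p₂)`. This converts the squared
K-means error into a multiple of `A I*`. -/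
theorem le_renyiHalf (d : ℕ) (p : Fin 2 → unitInterval) (h0 : (p 0 : ℝ) ≤ 1 / 2)
    (h1 : (p 1 : ℝ) ≤ 1 / 2) (hp : 0 < (p 0 : ℝ)) :
    d * ((p 0 : ℝ) - p 1) ^ 2 / (2 * (p 0 + p 1)) ≤ renyiHalf d p := by
  have a1 := (p 1).2.1
  set B := √(1 - (p 0 : ℝ)) * √(1 - (p 1 : ℝ)) + √((p 0 : ℝ) * (p 1 : ℝ)) with hB
  have hBpos : 0 < B := by
    have : 0 < √(1 - (p 0 : ℝ)) := Real.sqrt_pos.2 (by linarith)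
    have : 0 < √(1 - (p 1 : ℝ)) := Real.sqrt_pos.2 (by linarith)
    positivity
  have hlog := Real.log_le_sub_one_of_pos hBpos
  have hle := renyiHalf_arg_le_one p
  rw [← hB] at hle
  have hh : ((p 0 : ℝ) - p 1) ^ 2 / (2 * (p 0 + p 1)) ≤ (√(p 0 : ℝ) - √(p 1 : ℝ)) ^ 2 := by
    have s0 := Real.sq_sqrt hp.le
    have s1 := Real.sq_sqrt a1
    rw [div_le_iff₀ (by positivity)]
    have e : ((p 0 : ℝ) - p 1) ^ 2 =
        (√(p 0 : ℝ) - √(p 1 : ℝ)) ^ 2 * (√(p 0 : ℝ) + √(p 1 : ℝ)) ^ 2 := by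
      have : ((p 0 : ℝ) - p 1) ^ 2 = (√(p 0 : ℝ) ^ 2 - √(p 1 : ℝ) ^ 2) ^ 2 := by rw [s0, s1]
      rw [this]; ring
    rw [e]
    refine mul_le_mul_of_nonneg_left ?_ (sq_nonneg _)
    nlinarith [sq_nonneg (√(p 0 : ℝ) - √(p 1 : ℝ))]
  unfold renyiHalf
  rw [← hB, mul_div_assoc]
  have : (d : ℝ) * (((p 0 : ℝ) - p 1) ^ 2 / (2 * (p 0 + p 1))) ≤ d * (-2 * Real.log B) := by
    refine mul_le_mul_of_nonneg_left ?_ (by positivity)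
    linarith
  linarith

/-- Dropping `√(p₁p₂)` from the logarithm suffices. The bound turns `A = o(I*)` into `A = o(d p₁)`,
which separates the centres. -/
theorem renyiHalf_le (d : ℕ) (p : Fin 2 → unitInterval) (h0 : (p 0 : ℝ) ≤ 1 / 2)
    (h1 : (p 1 : ℝ) ≤ 1 / 2) : renyiHalf d p ≤ 2 * d * (p 0 + p 1) := by
  have key {t : ℝ} (ht0 : 0 ≤ t) (ht : t ≤ 1 / 2) : -t ≤ Real.log √(1 - t) := by
    rw [Real.log_sqrt (by linarith)]
    have := Real.one_sub_inv_le_log_of_pos (show 0 < 1 - t by linarith)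
    have : (1 - t)⁻¹ ≤ 1 + 2 * t := by
      rw [inv_le_iff_one_le_mul₀ (by linarith)]
      nlinarith
    linarith
  have q0 : 0 < √(1 - (p 0 : ℝ)) := Real.sqrt_pos.2 (by linarith)
  have q1 : 0 < √(1 - (p 1 : ℝ)) := Real.sqrt_pos.2 (by linarith)
  have hlog : Real.log (√(1 - (p 0 : ℝ)) * √(1 - (p 1 : ℝ))) ≤
      Real.log (√(1 - (p 0 : ℝ)) * √(1 - (p 1 : ℝ)) + √((p 0 : ℝ) * (p 1 : ℝ))) :=
    Real.log_le_log (by positivity) (le_add_of_nonneg_right (Real.sqrt_nonneg _))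
  rw [Real.log_mul q0.ne' q1.ne'] at hlog
  have k0 := key (p 0).2.1 h0
  have k1 := key (p 1).2.1 h1
  unfold renyiHalf
  have hd : (0 : ℝ) ≤ d := by positivity
  have : -Real.log (√(1 - (p 0 : ℝ)) * √(1 - (p 1 : ℝ)) + √((p 0 : ℝ) * (p 1 : ℝ))) ≤
    p 0 + p 1 := by linarith
  nlinarith [mul_le_mul_of_nonneg_left this hd]

/-! ### The bound for K-means -/

theorem labelCount_add {ι : Type*} [Fintype ι] (z : ι → Fin 2) :
    labelCount z 0 + labelCount z 1 = Fintype.card ι := by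
  classical
  unfold labelCount
  have : (Finset.univ.filter fun j => z j = 1) = Finset.univ.filter fun j => ¬ z j = 0 := by
    ext j
    simp only [Finset.mem_filter, Finset.mem_univ, true_and]
    omega
  rw [this, Finset.card_filter_add_card_filter_not, Finset.card_univ]

/-- To bound the probability of `E` from below, cover its complement by an unlikely set. -/
theorem one_sub_le_measureReal {Ω : Type*} [MeasurableSpace Ω] [DiscreteMeasurableSpace Ω]
    {μ : Measure Ω} [IsProbabilityMeasure μ] {E B : Set Ω} {δ : ℝ} (h : ∀ x, x ∉ B → x ∈ E)
    (hB : μ.real B ≤ δ) : 1 - δ ≤ μ.real E := by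
  have h1 : μ.real Eᶜ ≤ μ.real B := measureReal_mono fun x hx => by_contra fun hb => hx (h x hb)
  rw [probReal_compl_eq_one_sub .of_discrete] at h1
  linarith

/-- The non-asymptotic form of the bound for K-means. -/
theorem le_fixedLabelLaw_real_kmeansEvent {n d : ℕ} (hd : 0 < d) (hn : 0 < n)
    {p : Fin 2 → unitInterval} {z : Fin n → Fin 2} {γ K β A I : ℝ} (hγ : 2 < γ) (hK : 1 ≤ K)
    (hβ : 0 < β) (hp : ∀ m, 1 ≤ (d : ℝ) * p m) (hpK : (p 1 : ℝ) ≤ K * p 0)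
    (hcount : ∀ m, β * n + 1 ≤ labelCount z m) (hne : (p 0 : ℝ) - p 1 ≠ 0)
    (hA : A = γ * ((p 0 : ℝ) / ((p 0 : ℝ) - p 1)) ^ 2 * (1 + 1 / (n * (p 0 : ℝ))))
    (hI : d * ((p 0 : ℝ) - p 1) ^ 2 / (2 * (p 0 + p 1)) ≤ I)
    (hAp : 1600 * K * A < β * (d * p 0)) :
    1 - (10 : ℝ) ^ (-γ) ≤ (fixedLabelLaw d p z).real
      (kmeansEvent d p z (10 * √(100 * K * (1 + K) / β * (A * I)) / d)) := by
  have hd' : (0 : ℝ) < d := by exact_mod_cast hd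
  have hn' : (0 : ℝ) < n := by exact_mod_cast hn
  have hp0 : 0 < (p 0 : ℝ) := by
    by_contra! h
    nlinarith [hp 0]
  have hP (m : Fin 2) : (p m : ℝ) ≤ K * p 0 := by
    fin_cases m
    · exact le_mul_of_one_le_left hp0.le hK
    · exact hpK
  refine one_sub_le_measureReal (fun x hx => ?_) (fixedLabelLaw_real_sum_sq_ge_le hd p z hp hP hγ)
  simp only [Set.mem_ofPred_eq, not_le] at hx
  set D : ℝ := (p 0 : ℝ) - p 1 with hD
  have hD2 : 0 < D ^ 2 := by positivity
  have hA0 : 0 ≤ A := by rw [hA]; positivity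
  -- `A` is the variation bound measured in units of `n d D² / p 0`.
  have hAe : γ * (d * (n * p 0 + 1)) = A * (n * d * D ^ 2 / p 0) := by
    rw [hA]; field_simp
  set w := 50 * γ * (d * (n * (K * p 0) + 1)) with hw
  have hwA : w ≤ 50 * K * (A * (n * d * D ^ 2 / p 0)) := by
    rw [← hAe, hw]
    have : d * (n * (K * p 0) + 1) ≤ K * (d * (n * p 0 + 1)) := by nlinarith
    nlinarith
  have hDI : d * D ^ 2 / p 0 ≤ 2 * (1 + K) * I := by
    have : d * D ^ 2 / (2 * ((1 + K) * p 0)) ≤ d * D ^ 2 / (2 * (p 0 + p 1)) := by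
      have := (p 1).2.1
      gcongr
      linarith
    have h2 := this.trans hI
    rw [div_le_iff₀ (by positivity)] at h2 ⊢
    linarith
  refine mem_kmeansEvent hd (by positivity : 0 < β * n) hx.le hcount ?_ ?_
  -- In the same units the squared separation is `β d p 0`, so `hAp` suffices, with `1600 = 32 ·
  -- 50`.
  · have e : β * n * (d * D) ^ 2 = β * (d * p 0) * (n * d * D ^ 2 / p 0) := by field_simp
    rw [e]
    have : 0 < n * d * D ^ 2 / p 0 := by positivity
    nlinarith
  · have : w / (β * n) ≤ 100 * K * (1 + K) / β * (A * I) := by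
      rw [div_le_iff₀ (by positivity)]
      have e : 100 * K * (1 + K) / β * (A * I) * (β * n) =
          50 * K * (A * n) * (2 * (1 + K) * I) := by field_simp; ring
      rw [e]
      have := mul_le_mul_of_nonneg_left hDI (by positivity : 0 ≤ 50 * K * (A * n))
      refine hwA.trans (le_trans (le_of_eq ?_) this)
      ring
    gcongr

theorem Regime.eventually_one_le {n d : ℕ → ℕ} {p : ℕ → Fin 2 → unitInterval}
    (h : Regime n d p) (R : ℝ) (m : Fin 2) : ∀ᶠ k in atTop, R ≤ (d k : ℝ) * p k m := by
  have hR : (0 : ℝ) < |R| + 1 := by positivity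
  filter_upwards [(h.inv_d_small m).bound (inv_pos.2 hR)] with k hk
  have hd : (0 : ℝ) < d k := by exact_mod_cast h.d_pos k
  rw [Real.norm_of_nonneg (by positivity), Real.norm_of_nonneg (p k m).2.1] at hk
  have := mul_le_mul_of_nonneg_left hk (by positivity : 0 ≤ (d k : ℝ) * (|R| + 1))
  have e1 : (d k : ℝ) * (|R| + 1) * (d k : ℝ)⁻¹ = |R| + 1 := by field_simp
  have e2 : (d k : ℝ) * (|R| + 1) * ((|R| + 1)⁻¹ * p k m) = d k * p k m := by field_simp
  rw [e1, e2] at this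
  linarith [le_abs_self R]

theorem Regime.eventually_le_half {n d : ℕ → ℕ} {p : ℕ → Fin 2 → unitInterval}
    (h : Regime n d p) (m : Fin 2) : ∀ᶠ k in atTop, (p k m : ℝ) ≤ 1 / 2 :=
  (h.p_small m).eventually_le_const (by norm_num)

theorem exists_eventually_le_mul {f g : ℕ → ℝ} (hf : ∀ k, 0 ≤ f k) (hg : ∀ k, 0 ≤ g k)
    (h : f =O[atTop] g) : ∃ K : ℝ, 1 ≤ K ∧ ∀ᶠ k in atTop, f k ≤ K * g k := by
  obtain ⟨c, hc⟩ := h.bound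
  refine ⟨max c 1, le_max_right _ _, ?_⟩
  filter_upwards [hc] with k hk
  rw [Real.norm_of_nonneg (hf k), Real.norm_of_nonneg (hg k)] at hk
  exact hk.trans (mul_le_mul_of_nonneg_right (le_max_left _ _) (hg k))

/-- K-means estimates are consistent, with the absolute constant `1` in the separation conditions. -/
theorem kmeans_consistent (n d : ℕ → ℕ) (p : ℕ → Fin 2 → unitInterval)
    (z : ∀ k, Fin (n k) → Fin 2) (γ : ℕ → ℝ) (hreg : Regime n d p)
    (hcount : (fun k => (labelCount (z k) 0 : ℝ)) =Θ[atTop] fun k => (labelCount (z k) 1 : ℝ))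
    (hγ : ∀ k, 2 < γ k)
    (hsep : ∀ k, γ k * (p k 0 : ℝ) ≤ d k * ((p k 0 : ℝ) - p k 1) ^ 2)
    (hI : (fun k => γ k * ((p k 0 : ℝ) / ((p k 0 : ℝ) - p k 1)) ^ 2 *
      (1 + 1 / (n k * (p k 0 : ℝ)))) =o[atTop] fun k => renyiHalf (d k) (p k)) :
    ∃ c : ℕ → ℝ, (∀ k, 0 < c k) ∧ Tendsto c atTop (𝓝 0) ∧ ∀ᶠ k in atTop,
      1 - (10 : ℝ) ^ (-γ k) ≤ (fixedLabelLaw (d k) (p k) (z k)).real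
        (kmeansEvent (d k) (p k) (z k) (c k * renyiHalf (d k) (p k) / d k)) := by
  obtain ⟨K, hK, hpK⟩ := exists_eventually_le_mul (fun k => (p k 1).2.1) (fun k => (p k 0).2.1)
    hreg.same_order.2
  obtain ⟨K₁, hK₁, hc₁⟩ := exists_eventually_le_mul (fun k => Nat.cast_nonneg _)
    (fun k => Nat.cast_nonneg _) hcount.1
  obtain ⟨K₂, hK₂, hc₂⟩ := exists_eventually_le_mul (fun k => Nat.cast_nonneg _)
    (fun k => Nat.cast_nonneg _) hcount.2
  set A : ℕ → ℝ := fun k => γ k * ((p k 0 : ℝ) / ((p k 0 : ℝ) - p k 1)) ^ 2 *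
    (1 + 1 / (n k * (p k 0 : ℝ))) with hA
  set I : ℕ → ℝ := fun k => renyiHalf (d k) (p k) with hIdef
  set K' := K₁ + K₂ with hK'
  -- Each cluster holds at least `2βn` points; once `βn ≥ 1`, half of that covers the spare `1`.
  set β : ℝ := (2 * (1 + K'))⁻¹ with hβ
  have hβ0 : 0 < β := by positivity
  have hβ1 : β * (2 * (1 + K')) = 1 := inv_mul_cancel₀ (by positivity)
  -- Chosen so that `A ≤ ε I ≤ 2ε d (1 + K) p 0` makes `1600 K A` at most half of `β d p 0`.
  set ε : ℝ := β / (1600 * K * (2 * (1 + K)) * 2) with hε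
  have hε0 : 0 < ε := by positivity
  set Q : ℝ := 100 * K * (1 + K) / β with hQ
  -- The first term comes from `√(A I) = √(A/I) · I`; the second only makes `c k` strictly positive.
  have hlim : Tendsto (fun k => 10 * √(Q * |A k / I k|) + 1 / ((k : ℝ) + 1)) atTop (𝓝 0) := by
    have h1 := (hI.tendsto_div_nhds_zero).abs.const_mul Q
    have h2 := ((Real.continuous_sqrt.tendsto _).comp h1).const_mul 10
    have h3 := h2.add (tendsto_one_div_add_atTop_nhds_zero_nat (𝕜 := ℝ))
    simpa using h3
  refine ⟨_, fun k => by positivity, hlim, ?_⟩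
  have hn := hreg.sample_tendsto.eventually_ge_atTop (⌈β⁻¹⌉₊ + 1)
  filter_upwards [hpK, hc₁, hc₂, hn, hreg.eventually_one_le 1 0, hreg.eventually_one_le 1 1,
    hreg.eventually_le_half 0, hreg.eventually_le_half 1, hI.bound hε0]
    with k hpK hc₁ hc₂ hn hp0 hp1 hh0 hh1 hAI
  have hd : (0 : ℝ) < d k := by exact_mod_cast hreg.d_pos k
  have hp0pos : 0 < (p k 0 : ℝ) := by
    by_contra! h
    nlinarith
  have hγk := hγ k
  -- Needed because at `p₁ = p₂` the quotient in `A` would be `0` by convention.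
  have hne : (p k 0 : ℝ) - p k 1 ≠ 0 := by
    intro h
    have := hsep k
    rw [h] at this
    nlinarith
  have hnβ : β⁻¹ + 1 ≤ n k := by
    have h1 : ((⌈β⁻¹⌉₊ + 1 : ℕ) : ℝ) ≤ n k := by exact_mod_cast hn
    push_cast at h1
    linarith [Nat.le_ceil β⁻¹]
  have hnpos : (0 : ℝ) < n k := by have := inv_pos.2 hβ0; linarith
  have hβn : 1 ≤ β * n k := by
    have := mul_le_mul_of_nonneg_left hnβ hβ0.le
    rw [mul_add, mul_inv_cancel₀ hβ0.ne'] at this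
    linarith
  have htot : (labelCount (z k) 0 : ℝ) + labelCount (z k) 1 = n k := by
    have := labelCount_add (z k)
    rw [Fintype.card_fin] at this
    exact_mod_cast this
  have hc0n : (0 : ℝ) ≤ labelCount (z k) 0 := Nat.cast_nonneg _
  have hc1n : (0 : ℝ) ≤ labelCount (z k) 1 := Nat.cast_nonneg _
  have hcnt (m : Fin 2) : β * n k + 1 ≤ labelCount (z k) m := by
    have hm : (n k : ℝ) ≤ (1 + K') * labelCount (z k) m := by
      fin_cases m
      · simp only [Fin.zero_eta]; nlinarith
      · simp only [Fin.mk_one]; nlinarith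
    have h2 := mul_le_mul_of_nonneg_left hm (by positivity : 0 ≤ 2 * β)
    have e : 2 * β * ((1 + K') * labelCount (z k) m) =
      β * (2 * (1 + K')) * labelCount (z k) m := by ring
    rw [e, hβ1] at h2
    linarith
  have hIlow := le_renyiHalf (d k) (p k) hh0 hh1 hp0pos
  have hIup := renyiHalf_le (d k) (p k) hh0 hh1
  have hp1n := (p k 1).2.1
  have hIpos : 0 < I k := lt_of_lt_of_le (by positivity) hIlow
  have hApos : 0 ≤ A k := by simp only [hA]; positivity
  rw [Real.norm_of_nonneg hApos, Real.norm_of_nonneg hIpos.le] at hAI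
  have hAp : 1600 * K * A k < β * (d k * p k 0) := by
    have h1 : A k ≤ ε * (2 * d k * ((1 + K) * p k 0)) := by
      refine hAI.trans (mul_le_mul_of_nonneg_left (hIup.trans ?_) hε0.le)
      gcongr
      linarith
    have h2 := mul_le_mul_of_nonneg_left h1 (by positivity : 0 ≤ 1600 * K)
    have e : 1600 * K * (ε * (2 * d k * ((1 + K) * p k 0))) = β * (d k * p k 0) / 2 := by
      rw [hε]; field_simp
    have : 0 < β * (d k * p k 0) := by positivity
    linarith
  have := le_fixedLabelLaw_real_kmeansEvent (hreg.d_pos k) (by exact_mod_cast hnpos) hγk hK hβ0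
    (Fin.forall_fin_two.2 ⟨hp0, hp1⟩) hpK hcnt hne rfl hIlow hAp
  refine this.trans (measureReal_mono fun x hx i zt h1 h2 => (hx i zt h1 h2).trans ?_)
  have e : Q * (A k * I k) = Q * |A k / I k| * I k ^ 2 := by
    rw [abs_of_nonneg (by positivity)]
    field_simp
  change 10 * √(Q * (A k * I k)) / d k ≤ (10 * √(Q * |A k / I k|) + 1 / ((k : ℝ) + 1)) * I k / d k
  rw [e, Real.sqrt_mul (by positivity), Real.sqrt_sq hIpos.le]
  have : 0 ≤ 1 / ((k : ℝ) + 1) * I k := by positivity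
  refine div_le_div_of_nonneg_right ?_ hd.le
  linarith

/-! ### Moments and tails of the mixture -/

instance (n d : ℕ) (p : Fin 2 → unitInterval) : IsProbabilityMeasure (mixtureLaw n d p) := by
  unfold mixtureLaw; infer_instance

theorem integrable_mixture (d : ℕ) (p : Fin 2 → unitInterval) (f : ℕ → ℝ) :
    Integrable f (mixture d p) :=
  ((integrable_binomial f).smul_measure (by simp)).add_measure
    ((integrable_binomial f).smul_measure (by simp))

theorem integral_mixture (d : ℕ) (p : Fin 2 → unitInterval) (f : ℕ → ℝ) :
    ∫ x, f x ∂mixture d p =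
      (∫ x, f x ∂binomial d (p 0) + ∫ x, f x ∂binomial d (p 1)) / 2 := by
  unfold mixture
  rw [integral_add_measure ((integrable_binomial f).smul_measure (by simp))
    ((integrable_binomial f).smul_measure (by simp)), integral_smul_measure,
    integral_smul_measure]
  simp only [ENNReal.toReal_inv, ENNReal.toReal_ofNat, smul_eq_mul]
  ring

theorem integral_id_binomial (d : ℕ) (p : unitInterval) :
    ∫ x, (x : ℝ) ∂binomial d p = d * p := by
  have h := congrArg (Polynomial.eval (p : ℝ)) (bernsteinPolynomial.sum_smul ℝ d)
  rw [Polynomial.eval_finsetSum] at h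
  rw [integral_binomial, ← Nat.range_succ_eq_Iic]
  simp only [bernsteinPolynomial, nsmul_eq_mul, Polynomial.eval_mul, Polynomial.eval_natCast,
    Polynomial.eval_pow, Polynomial.eval_X, Polynomial.eval_sub, Polynomial.eval_one] at h
  rw [← h]
  exact Finset.sum_congr rfl fun k _ => by rw [smul_eq_mul, mul_comm]

/-- The second factorial moment, read off an identity for Bernstein polynomials; it makes
`empMoment₂` unbiased for `(p₁² + p₂²)/2`. -/
theorem integral_sq_sub_binomial (d : ℕ) (p : unitInterval) :
    ∫ x, ((x : ℝ) ^ 2 - x) ∂binomial d p = d * ((d : ℝ) - 1) * (p : ℝ) ^ 2 := by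
  have h := congrArg (Polynomial.eval (p : ℝ)) (bernsteinPolynomial.sum_mul_smul ℝ d)
  rw [Polynomial.eval_finsetSum] at h
  rw [integral_binomial, ← Nat.range_succ_eq_Iic]
  simp only [bernsteinPolynomial, nsmul_eq_mul, Polynomial.eval_mul, Polynomial.eval_natCast,
    Polynomial.eval_pow, Polynomial.eval_X, Polynomial.eval_sub, Polynomial.eval_one] at h
  have cast_eq (k : ℕ) : ((k * (k - 1) : ℕ) : ℝ) = (k : ℝ) ^ 2 - k := by
    cases k <;> simp; ring
  have hd : (d : ℝ) * ((d : ℝ) - 1) = ((d * (d - 1) : ℕ) : ℝ) := by rw [cast_eq]; ring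
  rw [hd, ← h]
  exact Finset.sum_congr rfl fun k _ => by rw [smul_eq_mul, cast_eq, mul_comm]

section Moments

variable {d : ℕ} {p : Fin 2 → unitInterval} {μ : ℝ}

theorem integral_exp_mul_mixture_le (hμ : ∀ m, (d : ℝ) * p m ≤ μ) {s : ℝ} (hs : 0 ≤ s) :
    ∫ x, Real.exp (s * (x : ℝ)) ∂mixture d p ≤ Real.exp (μ * (Real.exp s - 1)) := by
  have h (m : Fin 2) : ∫ x, Real.exp (s * (x : ℝ)) ∂binomial d (p m) ≤
      Real.exp (μ * (Real.exp s - 1)) := by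
    refine (integral_exp_mul_binomial_le d (p m) s).trans (Real.exp_le_exp.2 ?_)
    exact mul_le_mul_of_nonneg_right (hμ m) (by linarith [Real.one_le_exp hs])
  rw [integral_mixture]
  linarith [h 0, h 1]

theorem integral_exp_div_mixture_le (hμ : ∀ m, (d : ℝ) * p m ≤ μ) (hμ1 : 1 ≤ μ) :
    ∫ x, Real.exp (μ⁻¹ * (x : ℝ)) ∂mixture d p ≤ 8 := by
  have hμ0 : 0 < μ := by linarith
  refine (integral_exp_mul_mixture_le hμ (by positivity)).trans ?_
  have hs1 : μ⁻¹ ≤ 1 := inv_le_one_of_one_le₀ hμ1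
  have hs0 : 0 < μ⁻¹ := by positivity
  have h := (abs_le.1 (Real.abs_exp_sub_one_sub_id_le (x := μ⁻¹)
    (by rwa [abs_of_pos hs0]))).2
  have h2 : μ * (Real.exp μ⁻¹ - 1) ≤ 2 := by
    have : Real.exp μ⁻¹ - 1 ≤ 2 * μ⁻¹ := by nlinarith
    have := mul_le_mul_of_nonneg_left this hμ0.le
    rwa [mul_left_comm, mul_inv_cancel₀ hμ0.ne', mul_one] at this
  refine (Real.exp_le_exp.2 h2).trans ?_
  have e : Real.exp 2 = Real.exp 1 ^ 2 := by rw [← Real.exp_nat_mul]; norm_num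
  have := Real.exp_one_lt_d9
  have := Real.exp_pos 1
  rw [e]
  nlinarith

/-- Apply `y^r / r! ≤ e^y` at `y = x/μ`, the scale at which the exponential moment is at most `8`.
-/
theorem integral_pow_mixture_le (hμ : ∀ m, (d : ℝ) * p m ≤ μ) (hμ1 : 1 ≤ μ) (r : ℕ) :
    ∫ x, (x : ℝ) ^ r ∂mixture d p ≤ r.factorial * 8 * μ ^ r := by
  have hμ0 : 0 < μ := by linarith
  have key (x : ℕ) : (x : ℝ) ^ r ≤ r.factorial * μ ^ r * Real.exp (μ⁻¹ * x) := by
    have h := Real.pow_div_factorial_le_exp (μ⁻¹ * (x : ℝ)) (by positivity) r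
    rw [div_le_iff₀ (by positivity), mul_pow, inv_pow] at h
    have := mul_le_mul_of_nonneg_left h (by positivity : 0 ≤ μ ^ r)
    rw [← mul_assoc, mul_inv_cancel₀ (by positivity), one_mul] at this
    linarith
  refine (integral_mono (integrable_mixture _ _ _) (integrable_mixture _ _ _) key).trans ?_
  rw [integral_const_mul]
  have := mul_le_mul_of_nonneg_left (integral_exp_div_mixture_le hμ hμ1)
    (by positivity : (0 : ℝ) ≤ r.factorial * μ ^ r)
  linarith

theorem mixture_real_ge_le (hμ : ∀ m, (d : ℝ) * p m ≤ μ) (hμ0 : 0 ≤ μ) (t : ℝ) :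
    (mixture d p).real {x | 2 * μ + t ≤ (x : ℝ)} ≤ Real.exp (-t) := by
  have h := measureReal_ge_le_exp (μ := mixture d p) (g := fun x => 1 * (x : ℝ))
    (integrable_mixture _ _ _) (integral_exp_mul_mixture_le hμ zero_le_one) (2 * μ + t)
  simp only [one_mul] at h
  refine h.trans (Real.exp_le_exp.2 ?_)
  have := Real.exp_one_lt_d9
  nlinarith

theorem mixtureLaw_real_exists_ge_le (n : ℕ) (hμ : ∀ m, (d : ℝ) * p m ≤ μ) (hμ0 : 0 ≤ μ)
    (t : ℝ) :
    (mixtureLaw n d p).real {x | ∃ j, 2 * μ + t ≤ (x j : ℝ)} ≤ n * Real.exp (-t) := by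
  have h1 : {x : Fin n → ℕ | ∃ j, 2 * μ + t ≤ (x j : ℝ)} =
      ⋃ j ∈ Finset.univ, {x : Fin n → ℕ | 2 * μ + t ≤ (x j : ℝ)} := by
    ext x; simp
  rw [h1]
  refine (measureReal_biUnion_finset_le _ _).trans ?_
  have h2 (j : Fin n) : (mixtureLaw n d p).real {x : Fin n → ℕ | 2 * μ + t ≤ (x j : ℝ)} ≤
      Real.exp (-t) := by
    refine le_trans (le_of_eq ?_) (mixture_real_ge_le (p := p) hμ hμ0 t)
    exact (measurePreserving_eval (fun _ : Fin n => mixture d p) j).measureReal_preimage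
      (MeasurableSet.of_discrete (s := {x : ℕ | 2 * μ + t ≤ (x : ℝ)})).nullMeasurableSet
  refine (Finset.sum_le_sum fun j _ => h2 j).trans ?_
  simp

end Moments

/-! ### Bernstein bounds for sums of nonnegative terms -/

section Concentration

variable {ν : Measure ℕ} [IsProbabilityMeasure ν] {f : ℕ → ℝ} {v l : ℝ}

/-- Bernstein-type upper tail of a sum of nonnegative terms, on the event that each is small. -/
theorem pi_real_sum_upper (n : ℕ) (hν : ∀ g : ℕ → ℝ, Integrable g ν) (hf : ∀ x, 0 ≤ f x)
    (hv : ∫ x, f x ^ 2 ∂ν ≤ v) (hl : 0 ≤ l) (t : ℝ) :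
    (Measure.pi fun _ : Fin n => ν).real
      {x | n * ∫ y, f y ∂ν + t ≤ ∑ j, f (x j) ∧ ∀ j, l * f (x j) ≤ 1} ≤
      Real.exp (n * (l ^ 2 * v) - l * t) := by
  classical
  -- Large values are replaced by `0`, so the quadratic bound on the exponential holds everywhere
  -- using only the second moment. On the event in question nothing is truncated.
  set g : ℕ → ℝ := fun x => if l * f x ≤ 1 then l * f x else 0 with hg
  have key (x : ℕ) : Real.exp (g x) ≤ 1 + (l * f x + l ^ 2 * f x ^ 2) := by
    have h0 : 0 ≤ l * f x := mul_nonneg hl (hf x)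
    simp only [hg]
    split_ifs with h
    · have := (abs_le.1 (Real.abs_exp_sub_one_sub_id_le (x := l * f x)
        (by rwa [abs_of_nonneg h0]))).2
      nlinarith
    · simp only [Real.exp_zero]
      nlinarith [sq_nonneg (l * f x)]
  have hmgf : ∫ x, Real.exp (g x) ∂ν ≤ Real.exp (l * ∫ y, f y ∂ν + l ^ 2 * v) := by
    refine (integral_mono (hν _) (hν _) key).trans ?_
    rw [integral_add (hν _) (hν _), integral_add (hν _) (hν _), integral_const_mul,
      integral_const_mul]
    simp only [integral_const, probReal_univ, one_smul]
    have h1 := mul_le_mul_of_nonneg_left hv (sq_nonneg l)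
    have h2 := Real.add_one_le_exp (l * ∫ y, f y ∂ν + l ^ 2 * v)
    linarith
  have := pi_real_sum_ge_le (fun _ : Fin n => ν) (fun _ => g) (fun _ => _) (fun _ => hν _)
    (fun _ => hmgf) (l * (n * ∫ y, f y ∂ν + t))
  refine (measureReal_mono (fun x hx => ?_)).trans (this.trans (le_of_eq ?_))
  · simp only [Set.mem_ofPred_eq] at hx ⊢
    have e : ∑ j, g (x j) = l * ∑ j, f (x j) := by
      rw [Finset.mul_sum]
      exact Finset.sum_congr rfl fun j _ => if_pos (hx.2 j)
    rw [e]
    exact mul_le_mul_of_nonneg_left hx.1 hl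
  · simp only [Finset.sum_const, Finset.card_univ, Fintype.card_fin, nsmul_eq_mul]
    ring_nf

/-- Lower tail of a sum of nonnegative terms. -/
theorem pi_real_sum_lower (n : ℕ) (hν : ∀ g : ℕ → ℝ, Integrable g ν) (hf : ∀ x, 0 ≤ f x)
    (hv : ∫ x, f x ^ 2 ∂ν ≤ v) (hl : 0 ≤ l) (t : ℝ) :
    (Measure.pi fun _ : Fin n => ν).real {x | ∑ j, f (x j) ≤ n * ∫ y, f y ∂ν - t} ≤
      Real.exp (n * (l ^ 2 * v) - l * t) := by
  -- No truncation here: `e^(-y) ≤ 1 - y + y²` for every `y ≥ 0`.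
  have key (x : ℕ) : Real.exp (-l * f x) ≤ 1 + (-l * f x + l ^ 2 * f x ^ 2) := by
    have h0 : 0 ≤ l * f x := mul_nonneg hl (hf x)
    rcases le_total (l * f x) 1 with h | h
    · have := (abs_le.1 (Real.abs_exp_sub_one_sub_id_le (x := -(l * f x))
        (by rwa [abs_neg, abs_of_nonneg h0]))).2
      rw [neg_mul]
      nlinarith
    · have : Real.exp (-l * f x) ≤ 1 := Real.exp_le_one_iff.2 (by linarith)
      nlinarith
  have hmgf : ∫ x, Real.exp (-l * f x) ∂ν ≤ Real.exp (-l * ∫ y, f y ∂ν + l ^ 2 * v) := by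
    refine (integral_mono (hν _) (hν _) key).trans ?_
    rw [integral_add (hν _) (hν _), integral_add (hν _) (hν _), integral_const_mul,
      integral_const_mul]
    simp only [integral_const, probReal_univ, one_smul]
    have h1 := mul_le_mul_of_nonneg_left hv (sq_nonneg l)
    have h2 := Real.add_one_le_exp (-l * ∫ y, f y ∂ν + l ^ 2 * v)
    linarith
  have := pi_real_sum_ge_le (fun _ : Fin n => ν) (fun _ x => -l * f x) (fun _ => _)
    (fun _ => hν _) (fun _ => hmgf) (-l * (n * ∫ y, f y ∂ν - t))
  refine (measureReal_mono (fun x hx => ?_)).trans (this.trans (le_of_eq ?_))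
  · simp only [Set.mem_ofPred_eq] at hx ⊢
    rw [← Finset.mul_sum]
    nlinarith
  · simp only [Finset.sum_const, Finset.card_univ, Fintype.card_fin, nsmul_eq_mul]
    ring_nf

/-- A sum of nonnegative terms with second moment at most `κ s²` deviates from its mean by at
most `(κ + 2) s √(n log n)`, unless some term exceeds `s √(n / log n)`. -/
theorem pi_real_abs_sum_sub_ge_le {n : ℕ} (hn : 1 < n) {κ s : ℝ}
    (hν : ∀ g : ℕ → ℝ, Integrable g ν) (hf : ∀ x, 0 ≤ f x) (hs : 0 < s)
    (hv : ∫ x, f x ^ 2 ∂ν ≤ κ * s ^ 2) :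
    (Measure.pi fun _ : Fin n => ν).real
      {x | (κ + 2) * √(n * Real.log n) * s ≤ |∑ j, f (x j) - n * ∫ y, f y ∂ν| ∧
        ∀ j, √(Real.log n / n) * f (x j) ≤ s} ≤ 2 * ((n : ℝ) ^ 2)⁻¹ := by
  have hn' : (0 : ℝ) < n := by positivity
  have hL : 0 < Real.log n := Real.log_pos (by exact_mod_cast hn)
  set L := Real.log n with hLdef
  -- The variance term becomes `κL` and `l t` becomes `(κ + 2)L`, leaving the exponent `-2L`, that
  -- is, `n⁻²`.
  set l : ℝ := √(L / n) / s with hl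
  set t : ℝ := (κ + 2) * √(n * L) * s with ht
  have hl0 : 0 ≤ l := by positivity
  have hsq : √(L / n) ^ 2 = L / n := Real.sq_sqrt (by positivity)
  have hexp : n * (l ^ 2 * (κ * s ^ 2)) - l * t = -(2 * L) := by
    have h1 : l ^ 2 * (κ * s ^ 2) = κ * (L / n) := by
      rw [hl, div_pow, hsq]; field_simp
    have h2 : √(L / n) * √(n * L) = L := by
      rw [← Real.sqrt_mul (by positivity)]
      have : L / n * (n * L) = L ^ 2 := by field_simp
      rw [this, Real.sqrt_sq hL.le]
    have h3 : l * t = (κ + 2) * (√(L / n) * √(n * L)) := by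
      rw [hl, ht]; field_simp
    rw [h1, h3, h2]
    field_simp
    ring
  have he : Real.exp (-(2 * L)) = ((n : ℝ) ^ 2)⁻¹ := by
    rw [Real.exp_neg, hLdef]
    congr 1
    have : 2 * Real.log n = ((2 : ℕ) : ℝ) * Real.log n := by norm_num
    rw [this, Real.exp_nat_mul, Real.exp_log hn']
  have hup := pi_real_sum_upper n hν hf hv hl0 t
  have hlo := pi_real_sum_lower n hν hf hv hl0 t
  rw [hexp, he] at hup hlo
  have hsub : {x : Fin n → ℕ | t ≤ |∑ j, f (x j) - n * ∫ y, f y ∂ν| ∧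
      ∀ j, √(L / n) * f (x j) ≤ s} ⊆
      {x | n * ∫ y, f y ∂ν + t ≤ ∑ j, f (x j) ∧ ∀ j, l * f (x j) ≤ 1} ∪
      {x | ∑ j, f (x j) ≤ n * ∫ y, f y ∂ν - t} := by
    rintro x ⟨h1, h2⟩
    rcases le_abs.1 h1 with h | h
    · refine Or.inl ⟨by linarith, fun j => ?_⟩
      rw [hl, div_mul_eq_mul_div, div_le_one hs]
      exact h2 j
    · exact Or.inr (by simp only [Set.mem_ofPred_eq]; linarith)
  refine (measureReal_mono hsub).trans ((measureReal_union_le _ _).trans ?_)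
  linarith

end Concentration

/-! ### The method of moments -/

/-- For `v ≥ 0` factor the difference of squares and drop `√v` from the sum. For `v ≤ 0` the root is
`0` by convention, and `|v - δ²| ≥ δ²`. -/
theorem abs_sqrt_sub_le {v δ : ℝ} (hδ : 0 < δ) : |√v - δ| ≤ |v - δ ^ 2| / δ := by
  rw [le_div_iff₀ hδ]
  rcases le_total 0 v with hv | hv
  · have e : v - δ ^ 2 = (√v - δ) * (√v + δ) := by
      have := Real.sq_sqrt hv
      linear_combination -this
    have h : 0 ≤ √v + δ := by positivity
    rw [e, abs_mul, abs_of_nonneg h]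
    exact mul_le_mul_of_nonneg_left (le_add_of_nonneg_left (Real.sqrt_nonneg v)) (abs_nonneg _)
  · rw [Real.sqrt_eq_zero_of_nonpos hv, zero_sub, abs_neg, abs_of_pos hδ, abs_of_nonpos (by nlinarith)]
    nlinarith

/-- Stability of the method of moments with respect to errors of the two moments. -/
theorem estError_momEstimate_le {ι : Type*} [Fintype ι] {d : ℕ} {x : ι → ℕ}
    {p : Fin 2 → unitInterval} (hlt : (p 1 : ℝ) < p 0) {e₁ e₂ : ℝ}
    (h₁ : |empMoment₁ d x - ((p 0 : ℝ) + p 1) / 2| ≤ e₁)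
    (h₂ : |empMoment₂ d x - ((p 0 : ℝ) ^ 2 + (p 1 : ℝ) ^ 2) / 2| ≤ e₂) :
    estError (momEstimate d x) p ≤
      2 * e₁ + 4 * (e₂ + e₁ * (2 * p 0 + e₁)) / ((p 0 : ℝ) - p 1) := by
  set M₁ := empMoment₁ d x
  set M₂ := empMoment₂ d x
  have hp1 := (p 1).2.1
  have he₁ : 0 ≤ e₁ := (abs_nonneg _).trans h₁
  have hΔ : 0 < ((p 0 : ℝ) - p 1) / 2 := by linarith
  have hV : |M₂ - M₁ ^ 2 - (((p 0 : ℝ) - p 1) / 2) ^ 2| ≤ e₂ + e₁ * (2 * p 0 + e₁) := by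
    have e : M₂ - M₁ ^ 2 - (((p 0 : ℝ) - p 1) / 2) ^ 2 =
        (M₂ - ((p 0 : ℝ) ^ 2 + (p 1 : ℝ) ^ 2) / 2) -
        (M₁ - ((p 0 : ℝ) + p 1) / 2) * (p 0 + p 1 + (M₁ - ((p 0 : ℝ) + p 1) / 2)) := by ring
    rw [e]
    refine (abs_sub _ _).trans (add_le_add h₂ ?_)
    rw [abs_mul]
    refine mul_le_mul h₁ ((abs_add_le _ _).trans (add_le_add ?_ h₁)) (abs_nonneg _) he₁
    rw [abs_of_nonneg (by linarith)]
    linarith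
  have hS : |√(M₂ - M₁ ^ 2) - ((p 0 : ℝ) - p 1) / 2| ≤
      (e₂ + e₁ * (2 * p 0 + e₁)) / (((p 0 : ℝ) - p 1) / 2) :=
    (abs_sqrt_sub_le hΔ).trans (div_le_div_of_nonneg_right hV hΔ.le)
  have e0 : M₁ + √(M₂ - M₁ ^ 2) - p 0 = (M₁ - ((p 0 : ℝ) + p 1) / 2) +
    (√(M₂ - M₁ ^ 2) - ((p 0 : ℝ) - p 1) / 2) := by ring
  have e1 : M₁ - √(M₂ - M₁ ^ 2) - p 1 = (M₁ - ((p 0 : ℝ) + p 1) / 2) -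
    (√(M₂ - M₁ ^ 2) - ((p 0 : ℝ) - p 1) / 2) := by ring
  have e2 : 4 * (e₂ + e₁ * (2 * p 0 + e₁)) / ((p 0 : ℝ) - p 1) =
      2 * ((e₂ + e₁ * (2 * p 0 + e₁)) / (((p 0 : ℝ) - p 1) / 2)) := by
    have : ((p 0 : ℝ) - p 1) ≠ 0 := by linarith
    field_simp
    ring
  change |M₁ + √(M₂ - M₁ ^ 2) - p 0| + |M₁ - √(M₂ - M₁ ^ 2) - p 1| ≤ _
  rw [e0, e1, e2]
  have t0 := abs_add_le (M₁ - ((p 0 : ℝ) + p 1) / 2) (√(M₂ - M₁ ^ 2) - ((p 0 : ℝ) - p 1) / 2)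
  have t1 := abs_sub (M₁ - ((p 0 : ℝ) + p 1) / 2) (√(M₂ - M₁ ^ 2) - ((p 0 : ℝ) - p 1) / 2)
  linarith

theorem card_leaveOut {n : ℕ} (i : Fin n) :
    (Fintype.card {j : Fin n // j ≠ i} : ℝ) = n - 1 := by
  have := sum_leaveOut (fun _ : Fin n => (1 : ℝ)) i
  simpa using this

/-- Deleting one small term hardly changes the deviation of a sum from its mean. -/
theorem abs_sum_leaveOut_sub_le {n : ℕ} {f : Fin n → ℝ} {i : Fin n} {m s t b : ℝ}
    (h : |∑ j, f j - n * m| ≤ t) (hf : 0 ≤ f i) (hfi : f i ≤ s * b) (hm0 : 0 ≤ m)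
    (hm : m ≤ s * b) :
    |∑ j : {j : Fin n // j ≠ i}, f j - (n - 1) * m| ≤ t + s * b := by
  rw [sum_leaveOut]
  have e : ∑ j, f j - f i - (n - 1) * m = (∑ j, f j - n * m) - (f i - m) := by ring
  rw [e]
  refine (abs_sub _ _).trans (add_le_add h (abs_le.2 ⟨?_, ?_⟩)) <;> linarith

/-- Leave-one-out sums close to their means give accurate method of moments estimates. -/
theorem estError_momEstimate_leaveOut_le {n d : ℕ} {p : Fin 2 → unitInterval} {x : Fin n → ℕ}
    {i : Fin n} {ρ : ℝ} (hn2 : (2 : ℝ) ≤ n) (hd2 : (2 : ℝ) ≤ d) (hρ0 : 0 ≤ ρ) (hρ1 : ρ ≤ 1)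
    (hlt : (p 1 : ℝ) < p 0)
    (hE₁ : |∑ j : {j : Fin n // j ≠ i}, (x j : ℝ) - (n - 1) * (d * (((p 0 : ℝ) + p 1) / 2))| ≤
      19 * (n * ρ) * (d * p 0))
    (hE₂ : |∑ j : {j : Fin n // j ≠ i}, ((x j : ℝ) ^ 2 - x j) -
        (n - 1) * (d * ((d : ℝ) - 1) * (((p 0 : ℝ) ^ 2 + (p 1 : ℝ) ^ 2) / 2))| ≤
      195 * (n * ρ) * (d * p 0) ^ 2) :
    estError (momEstimate d (leaveOut x i)) p ≤
      10000 * (ρ * (p 0 : ℝ) ^ 2 / ((p 0 : ℝ) - p 1)) := by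
  have hp1 := (p 1).2.1
  have hp0 : 0 < (p 0 : ℝ) := by linarith
  have hΔ : 0 < (p 0 : ℝ) - p 1 := by linarith
  have hN : 0 < (n : ℝ) - 1 := by linarith
  have hd1 : 0 < (d : ℝ) - 1 := by linarith
  have h₁ : |empMoment₁ d (leaveOut x i) - ((p 0 : ℝ) + p 1) / 2| ≤ 38 * ρ * p 0 := by
    have e : empMoment₁ d (leaveOut x i) - ((p 0 : ℝ) + p 1) / 2 =
        (∑ j : {j : Fin n // j ≠ i}, (x j : ℝ) - (n - 1) * (d * (((p 0 : ℝ) + p 1) / 2))) /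
          ((n - 1) * d) := by
      unfold empMoment₁
      rw [card_leaveOut]
      simp only [leaveOut]
      field_simp
    rw [e, abs_div, abs_of_pos (by positivity : 0 < ((n : ℝ) - 1) * d),
      div_le_iff₀ (by positivity)]
    refine hE₁.trans ?_
    have h1 : (n : ℝ) ≤ 2 * (n - 1) := by linarith
    have h2 := mul_le_mul_of_nonneg_left h1 (by positivity : 0 ≤ 19 * ρ * (d * p 0))
    linarith
  have h₂ : |empMoment₂ d (leaveOut x i) - ((p 0 : ℝ) ^ 2 + (p 1 : ℝ) ^ 2) / 2| ≤
      780 * ρ * (p 0 : ℝ) ^ 2 := by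
    have e : empMoment₂ d (leaveOut x i) - ((p 0 : ℝ) ^ 2 + (p 1 : ℝ) ^ 2) / 2 =
        (∑ j : {j : Fin n // j ≠ i}, ((x j : ℝ) ^ 2 - x j) -
          (n - 1) * (d * ((d : ℝ) - 1) * (((p 0 : ℝ) ^ 2 + (p 1 : ℝ) ^ 2) / 2))) /
          ((n - 1) * d * (d - 1)) := by
      unfold empMoment₂
      rw [card_leaveOut]
      simp only [leaveOut]
      field_simp
    rw [e, abs_div, abs_of_pos (by positivity : 0 < ((n : ℝ) - 1) * d * (d - 1)),
      div_le_iff₀ (by positivity)]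
    refine hE₂.trans ?_
    have h1 : (n : ℝ) * d ≤ 4 * ((n - 1) * (d - 1)) := by nlinarith
    have h2 := mul_le_mul_of_nonneg_left h1 (by positivity : 0 ≤ 195 * ρ * (d * (p 0 : ℝ) ^ 2))
    linarith
  refine (estError_momEstimate_le hlt h₁ h₂).trans ?_
  rw [← mul_div_assoc]
  have hs : 38 * ρ * (p 0 : ℝ) * (2 * p 0 + 38 * ρ * p 0) ≤ 1520 * ρ * (p 0 : ℝ) ^ 2 := by
    have h1 : 2 * (p 0 : ℝ) + 38 * ρ * p 0 ≤ 40 * p 0 := by nlinarith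
    have := mul_le_mul_of_nonneg_left h1 (by positivity : 0 ≤ 38 * ρ * (p 0 : ℝ))
    linarith
  have hq : ρ * (p 0 : ℝ) * (p 0 - p 1) ≤ ρ * (p 0 : ℝ) ^ 2 := by
    have := mul_le_mul_of_nonneg_left (show (p 0 : ℝ) - p 1 ≤ p 0 by linarith)
      (by positivity : 0 ≤ ρ * (p 0 : ℝ))
    linarith
  -- The constants add up to `76 + 4(780 + 1520) = 9276`.
  rw [← sub_nonneg]
  have : 10000 * (ρ * (p 0 : ℝ) ^ 2) / (p 0 - p 1) - (2 * (38 * ρ * p 0) +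
      4 * (780 * ρ * (p 0 : ℝ) ^ 2 + 38 * ρ * p 0 * (2 * p 0 + 38 * ρ * p 0)) / (p 0 - p 1)) =
      (10000 * (ρ * (p 0 : ℝ) ^ 2) - 76 * (ρ * p 0 * (p 0 - p 1)) -
      4 * (780 * ρ * (p 0 : ℝ) ^ 2 + 38 * ρ * p 0 * (2 * p 0 + 38 * ρ * p 0))) / (p 0 - p 1) := by
    field_simp
    ring
  rw [this]
  refine div_nonneg ?_ hΔ.le
  have : 0 ≤ ρ * (p 0 : ℝ) ^ 2 := by positivity
  linarith

/-- The non-asymptotic form of the bound for the method of moments. -/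
theorem le_mixtureLaw_real_momEvent {n d : ℕ} {p : Fin 2 → unitInterval} {L ρ : ℝ}
    (hL : L = Real.log n) (hL1 : 1 ≤ L) (hρ : ρ = √(L / n)) (hLρ : 36 * L ^ 2 * ρ ≤ 1)
    (hn : 2 ≤ n) (hd : 2 ≤ d) (hμ1 : 1 ≤ (d : ℝ) * p 0) (hlt : (p 1 : ℝ) < p 0) :
    1 - 14 * ((n : ℝ) ^ 2)⁻¹ ≤ (mixtureLaw n d p).real
      (momEvent n d p (10000 * (ρ * (p 0 : ℝ) ^ 2 / ((p 0 : ℝ) - p 1)))) := by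
  have hn2 : (2 : ℝ) ≤ n := by exact_mod_cast hn
  have hd2 : (2 : ℝ) ≤ d := by exact_mod_cast hd
  have hn' : (0 : ℝ) < n := by linarith
  have hp1 := (p 1).2.1
  have hp0 : 0 < (p 0 : ℝ) := by linarith
  have hΔ : 0 < (p 0 : ℝ) - p 1 := by linarith
  set μ : ℝ := (d : ℝ) * p 0 with hμdef
  have hμ0 : 0 < μ := by linarith
  have hμ (m : Fin 2) : (d : ℝ) * p m ≤ μ := by
    fin_cases m
    · exact le_rfl
    · exact mul_le_mul_of_nonneg_left hlt.le (by positivity)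
  have hL0 : 0 < L := by linarith
  have hρ0 : 0 < ρ := by rw [hρ]; positivity
  have hρ1 : ρ ≤ 1 := by
    have h1 : (1 : ℝ) ≤ L ^ 2 := one_le_pow₀ hL1
    have := mul_le_mul_of_nonneg_right h1 hρ0.le
    linarith
  set b : ℝ := √(n * L) with hb
  have hbρ : b = n * ρ := by
    rw [hb, hρ]
    have : (n : ℝ) * L = n ^ 2 * (L / n) := by field_simp
    rw [this, Real.sqrt_mul (by positivity), Real.sqrt_sq hn'.le]
  -- A term `y` with `ρ y ≤ s` is thus at most `s b`, so deleting it raises the constants `18 = 2!·8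
  -- + 2` and `194 = 4!·8 + 2` below by only one.
  have hρb : 1 ≤ ρ * b := by
    have : ρ * b = L := by
      have h : ρ ^ 2 = L / n := by rw [hρ]; exact Real.sq_sqrt (by positivity)
      rw [hbρ]
      have : ρ * (n * ρ) = n * ρ ^ 2 := by ring
      rw [this, h]
      field_simp
    linarith
  have hb1 : 1 ≤ b := hρb.trans (mul_le_of_le_one_left (Real.sqrt_nonneg _) hρ1)
  set f : ℕ → ℝ := fun x => (x : ℝ) with hf
  set g : ℕ → ℝ := fun x => (x : ℝ) ^ 2 - x with hg
  have hf0 (x : ℕ) : 0 ≤ f x := Nat.cast_nonneg x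
  have hg0 (x : ℕ) : 0 ≤ g x := by
    simp only [hg]
    rcases Nat.eq_zero_or_pos x with rfl | hx
    · simp
    · have : (1 : ℝ) ≤ x := by exact_mod_cast hx
      nlinarith
  have hmf : ∫ x, f x ∂mixture d p = d * (((p 0 : ℝ) + p 1) / 2) := by
    rw [integral_mixture]
    simp only [hf, integral_id_binomial]
    ring
  have hmg : ∫ x, g x ∂mixture d p = d * ((d : ℝ) - 1) * (((p 0 : ℝ) ^ 2 + (p 1 : ℝ) ^ 2) / 2) := by
    rw [integral_mixture]
    simp only [hg, integral_sq_sub_binomial]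
    ring
  have hvf : ∫ x, f x ^ 2 ∂mixture d p ≤ 16 * μ ^ 2 := by
    refine (integral_pow_mixture_le hμ hμ1 2).trans (le_of_eq ?_)
    norm_num [Nat.factorial]
  have hvg : ∫ x, g x ^ 2 ∂mixture d p ≤ 192 * (μ ^ 2) ^ 2 := by
    have h4 := integral_pow_mixture_le hμ hμ1 4
    have : ∫ x, g x ^ 2 ∂mixture d p ≤ ∫ x, (x : ℝ) ^ 4 ∂mixture d p := by
      refine integral_mono (integrable_mixture _ _ _) (integrable_mixture _ _ _) fun x => ?_
      have h0 := hg0 x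
      have h1 : g x ≤ (x : ℝ) ^ 2 := by simp [hg]
      calc g x ^ 2 ≤ ((x : ℝ) ^ 2) ^ 2 := pow_le_pow_left₀ h0 h1 2
        _ = (x : ℝ) ^ 4 := by ring
    refine this.trans (h4.trans (le_of_eq ?_))
    norm_num [Nat.factorial]
    ring
  have B₁ := pi_real_abs_sum_sub_ge_le (n := n) (by omega) (integrable_mixture d p) hf0 hμ0 hvf
  have B₂ := pi_real_abs_sum_sub_ge_le (n := n) (by omega) (integrable_mixture d p) hg0
    (by positivity : 0 < μ ^ 2) hvg
  have B₃ := mixtureLaw_real_exists_ge_le n hμ hμ0.le (4 * L)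
  rw [← hL, ← hρ, ← hb] at B₁ B₂
  have hexp : n * Real.exp (-(4 * L)) ≤ ((n : ℝ) ^ 2)⁻¹ := by
    have : Real.exp (-(4 * L)) = ((n : ℝ) ^ 4)⁻¹ := by
      rw [Real.exp_neg, hL, show 4 * Real.log n = ((4 : ℕ) : ℝ) * Real.log n by norm_num,
        Real.exp_nat_mul, Real.exp_log hn']
    rw [this, ← div_eq_mul_inv, div_le_iff₀ (by positivity), inv_mul_eq_div,
      le_div_iff₀ (by positivity)]
    have h1 : (n : ℝ) ^ 3 * 1 ≤ n ^ 3 * n :=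
      mul_le_mul_of_nonneg_left (by linarith) (by positivity)
    linarith
  refine one_sub_le_measureReal (fun x hx => ?_)
    ((measureReal_union_le _ _).trans (add_le_add ((measureReal_union_le _ _).trans
      (add_le_add B₁ B₂)) B₃) |>.trans ?_)
  swap
  · have : 0 ≤ ((n : ℝ) ^ 2)⁻¹ := by positivity
    linarith
  simp only [Set.mem_union, Set.mem_ofPred_eq, not_or, not_and, not_exists, not_le] at hx
  obtain ⟨⟨hx₁, hx₂⟩, hx₃⟩ := hx
  -- From `2μ + 4L` and `μ, L ≥ 1`. The factor `36 L²` in `hLρ` is the square of `6L`, as the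
  -- quadratic terms require.
  have hxB (j : Fin n) : (x j : ℝ) ≤ 6 * μ * L := by
    have h1 := hx₃ j
    have h2 := mul_le_mul_of_nonneg_left hL1 hμ0.le
    have h3 := mul_le_mul_of_nonneg_right hμ1 hL0.le
    linarith
  have hsf (j : Fin n) : ρ * f (x j) ≤ μ := by
    have h1 := mul_le_mul_of_nonneg_left (hxB j) hρ0.le
    have h2 : 6 * L * ρ ≤ 1 := by
      have := mul_le_mul_of_nonneg_right hL1 (by positivity : 0 ≤ L * ρ)
      have : 0 ≤ L * ρ := by positivity
      linarith
    have h3 := mul_le_mul_of_nonneg_left h2 hμ0.le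
    simp only [hf]
    linarith
  have hsg (j : Fin n) : ρ * g (x j) ≤ μ ^ 2 := by
    have h1 : g (x j) ≤ (6 * μ * L) ^ 2 :=
      le_trans (by simp [hg]) (pow_le_pow_left₀ (Nat.cast_nonneg _) (hxB j) 2)
    have h2 := mul_le_mul_of_nonneg_left h1 hρ0.le
    have h3 := mul_le_mul_of_nonneg_left hLρ (by positivity : 0 ≤ μ ^ 2)
    linarith
  have hD₁ : |∑ j, f (x j) - n * ∫ y, f y ∂mixture d p| ≤ 18 * b * μ := by
    by_contra! hcon
    obtain ⟨j, hj⟩ : ∃ j, μ < ρ * f (x j) := by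
      by_contra! hall
      exact absurd hall (by simpa using hx₁ (by linarith))
    exact absurd (hsf j) (not_le.2 hj)
  have hD₂ : |∑ j, g (x j) - n * ∫ y, g y ∂mixture d p| ≤ 194 * b * μ ^ 2 := by
    by_contra! hcon
    obtain ⟨j, hj⟩ : ∃ j, μ ^ 2 < ρ * g (x j) := by
      by_contra! hall
      exact absurd hall (by simpa using hx₂ (by linarith))
    exact absurd (hsg j) (not_le.2 hj)
  have hle {y s : ℝ} (hs : 0 < s) (h : ρ * y ≤ s) : y ≤ s * b := by
    have h1 : ρ * y ≤ ρ * (s * b) := by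
      have := mul_le_mul_of_nonneg_left hρb hs.le
      linarith
    exact le_of_mul_le_mul_left h1 hρ0
  have hmfμ : ∫ y, f y ∂mixture d p ≤ μ := by
    rw [hmf, hμdef]; gcongr; linarith
  have hmgμ : ∫ y, g y ∂mixture d p ≤ μ ^ 2 := by
    rw [hmg, hμdef, mul_pow]
    have hd1 : (d : ℝ) * (d - 1) ≤ d ^ 2 := by linarith
    have hp2 : (p 1 : ℝ) ^ 2 ≤ (p 0 : ℝ) ^ 2 := pow_le_pow_left₀ hp1 hlt.le 2
    exact mul_le_mul hd1 (by linarith) (by positivity) (by positivity)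
  intro i
  have hE₁ := abs_sum_leaveOut_sub_le (f := fun j => f (x j)) (i := i) hD₁ (hf0 _)
    (hle hμ0 (hsf i)) (integral_nonneg hf0) (hmfμ.trans (le_mul_of_one_le_right hμ0.le hb1))
  have hE₂ := abs_sum_leaveOut_sub_le (f := fun j => g (x j)) (i := i) hD₂ (hg0 _)
    (hle (by positivity) (hsg i)) (integral_nonneg hg0)
    (hmgμ.trans (le_mul_of_one_le_right (by positivity) hb1))
  rw [hbρ, hmf] at hE₁
  rw [hbρ, hmg] at hE₂
  exact estError_momEstimate_leaveOut_le hn2 hd2 hρ0.le hρ1 hlt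
    (hE₁.trans (le_of_eq (by ring))) (hE₂.trans (le_of_eq (by ring)))

theorem renyiHalf_eq_zero (d : ℕ) {p : Fin 2 → unitInterval} (h : (p 0 : ℝ) = p 1) :
    renyiHalf d p = 0 := by
  have h0 := (p 1).2.1
  have h1 := (p 1).2.2
  unfold renyiHalf
  rw [h, Real.mul_self_sqrt (by linarith), Real.sqrt_mul_self h0]
  simp

/-- Method of moments estimates are consistent. -/
theorem mom_consistent (n d : ℕ → ℕ) (p : ℕ → Fin 2 → unitInterval) (hreg : Regime n d p)
    (hle : ∀ k, (p k 1 : ℝ) ≤ p k 0)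
    (hI : (fun k => 1 + (p k 0 : ℝ) / |(p k 0 : ℝ) - p k 1| *
        √(d k * (p k 0 : ℝ) * (d k * (p k 0 : ℝ) + Real.log (n k)) * Real.log (n k) / n k))
      =o[atTop] fun k => renyiHalf (d k) (p k)) :
    ∃ c : ℕ → ℝ, (∀ k, 0 < c k) ∧ Tendsto c atTop (𝓝 0) ∧ ∀ᶠ k in atTop,
      1 - 14 * ((n k : ℝ) ^ 2)⁻¹ ≤ (mixtureLaw (n k) (d k) (p k)).real
        (momEvent (n k) (d k) (p k) (c k * renyiHalf (d k) (p k) / d k)) := by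
  set F : ℕ → ℝ := fun k => 1 + (p k 0 : ℝ) / |(p k 0 : ℝ) - p k 1| *
    √(d k * (p k 0 : ℝ) * (d k * (p k 0 : ℝ) + Real.log (n k)) * Real.log (n k) / n k) with hF
  have hlim : Tendsto (fun k => 10000 * |F k / renyiHalf (d k) (p k)| + 1 / ((k : ℝ) + 1))
      atTop (𝓝 0) := by
    have h1 := (hI.tendsto_div_nhds_zero).abs.const_mul 10000
    have h2 := h1.add (tendsto_one_div_add_atTop_nhds_zero_nat (𝕜 := ℝ))
    simpa using h2
  refine ⟨_, fun k => by positivity, hlim, ?_⟩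
  have hncast : Tendsto (fun k => (n k : ℝ)) atTop atTop :=
    tendsto_natCast_atTop_atTop.comp hreg.sample_tendsto
  have hlog : ∀ᶠ k in atTop, 1 ≤ Real.log (n k) :=
    (Real.tendsto_log_atTop.comp hncast).eventually_ge_atTop 1
  -- The square of `36 L² √(L/n) ≤ 1`.
  have hpow : ∀ᶠ k in atTop, 1296 * Real.log (n k) ^ 5 ≤ n k := by
    have h := hncast.eventually ((Real.isLittleO_pow_log_id_atTop (n := 5)).bound
      (by norm_num : (0 : ℝ) < 1296⁻¹))
    filter_upwards [h] with k hk
    simp only [id, Real.norm_natCast] at hk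
    have := le_trans (le_abs_self _) hk
    linarith
  filter_upwards [hlog, hpow, hreg.eventually_one_le 2 0, hreg.eventually_le_half 0,
    hreg.eventually_le_half 1, hreg.sample_tendsto.eventually_ge_atTop 2,
    hI.bound (by norm_num : (0 : ℝ) < 1)] with k hL1 hL5 hμ hh0 hh1 hn hFI
  have hd : (0 : ℝ) < d k := by exact_mod_cast hreg.d_pos k
  have hn' : (0 : ℝ) < n k := by have : 0 < n k := by omega
                                 exact_mod_cast this
  have hp0 : 0 < (p k 0 : ℝ) := by
    by_contra! h
    nlinarith
  have hd2 : 2 ≤ d k := by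
    have : (2 : ℝ) ≤ d k := hμ.trans (mul_le_of_le_one_right hd.le (p k 0).2.2)
    exact_mod_cast this
  have hF1 : 1 ≤ F k := le_add_of_nonneg_right (by positivity)
  -- The summand `1` in `F` forces a nonzero divergence, hence `p₂ < p₁` strictly.
  have hI0 : renyiHalf (d k) (p k) ≠ 0 := by
    intro h
    rw [h, norm_zero, mul_zero, Real.norm_of_nonneg (by linarith)] at hFI
    linarith
  have hlt : (p k 1 : ℝ) < p k 0 :=
    lt_of_le_of_ne (hle k) fun h => hI0 (renyiHalf_eq_zero _ h.symm)
  have hIpos : 0 < renyiHalf (d k) (p k) := by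
    refine lt_of_le_of_ne (le_trans ?_ (le_renyiHalf (d k) (p k) hh0 hh1 hp0)) hI0.symm
    have := (p k 1).2.1
    positivity
  have hLρ : 36 * Real.log (n k) ^ 2 * √(Real.log (n k) / n k) ≤ 1 := by
    have h36 : 0 < 36 * Real.log (n k) ^ 2 := by positivity
    rw [← le_div_iff₀' h36]
    refine Real.sqrt_le_iff.2 ⟨by positivity, ?_⟩
    rw [div_pow, one_pow, div_le_div_iff₀ hn' (by positivity)]
    refine le_trans (le_of_eq ?_) (hL5.trans (one_mul _).symm.le)
    ring
  refine (le_mixtureLaw_real_momEvent rfl hL1 rfl hLρ hn hd2 (by linarith) hlt).trans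
    (measureReal_mono fun x hx i => (hx i).trans ?_)
  have hΔ : 0 < (p k 0 : ℝ) - p k 1 := by linarith
  -- Only the part `(d p₁)²` of `d p₁ (d p₁ + log n)` is needed.
  have hroot : d k * (p k 0 : ℝ) * √(Real.log (n k) / n k) ≤
      √(d k * (p k 0 : ℝ) * (d k * (p k 0 : ℝ) + Real.log (n k)) * Real.log (n k) / n k) := by
    refine Real.le_sqrt_of_sq_le ?_
    rw [mul_pow, Real.sq_sqrt (by positivity), mul_div_assoc]
    refine mul_le_mul_of_nonneg_right ?_ (by positivity)
    have : 0 ≤ d k * (p k 0 : ℝ) * Real.log (n k) := by positivity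
    linarith
  have hFd : √(Real.log (n k) / n k) * (p k 0 : ℝ) ^ 2 / ((p k 0 : ℝ) - p k 1) ≤ F k / d k := by
    rw [le_div_iff₀ hd]
    have h1 := mul_le_mul_of_nonneg_left hroot
      (by positivity : 0 ≤ (p k 0 : ℝ) / ((p k 0 : ℝ) - p k 1))
    have e : √(Real.log (n k) / n k) * (p k 0 : ℝ) ^ 2 / ((p k 0 : ℝ) - p k 1) * d k =
        (p k 0 : ℝ) / ((p k 0 : ℝ) - p k 1) *
          (d k * (p k 0 : ℝ) * √(Real.log (n k) / n k)) := by ring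
    rw [e]
    simp only [hF]
    rw [abs_of_pos hΔ]
    linarith
  have hFk : F k = |F k / renyiHalf (d k) (p k)| * renyiHalf (d k) (p k) := by
    rw [abs_of_nonneg (by positivity)]
    field_simp
  have hrest : 0 ≤ 1 / ((k : ℝ) + 1) * renyiHalf (d k) (p k) := by positivity
  refine (mul_le_mul_of_nonneg_left hFd (by norm_num)).trans ?_
  rw [← mul_div_assoc]
  refine div_le_div_of_nonneg_right ?_ hd.le
  linarith

end BinomialMixture

theorem lemma6 :
    (∃ C : ℝ, 0 < C ∧
      ∀ (n d : ℕ → ℕ) (p : ℕ → Fin 2 → unitInterval) (z : ∀ k, Fin (n k) → Fin 2) (γ : ℕ → ℝ),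
        BinomialMixture.Regime n d p →
        ((fun k => (BinomialMixture.labelCount (z k) 0 : ℝ)) =Θ[atTop]
          fun k => (BinomialMixture.labelCount (z k) 1 : ℝ)) →
        (∀ k, 2 < γ k) →
        (∀ k, C * γ k * (p k 0 : ℝ) ≤ d k * ((p k 0 : ℝ) - p k 1) ^ 2) →
        (∀ k, C * γ k ≤ n k * d k * ((p k 0 : ℝ) - p k 1) ^ 2) →
        ((fun k => C * γ k * ((p k 0 : ℝ) / ((p k 0 : ℝ) - p k 1)) ^ 2 *
            (1 + 1 / (n k * (p k 0 : ℝ)))) =o[atTop]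
          fun k => BinomialMixture.renyiHalf (d k) (p k)) →
        ∃ c : ℕ → ℝ, (∀ k, 0 < c k) ∧ Tendsto c atTop (𝓝 0) ∧
          ∀ᶠ k in atTop,
            1 - (10 : ℝ) ^ (-γ k) ≤
              (BinomialMixture.fixedLabelLaw (d k) (p k) (z k)).real
                (BinomialMixture.kmeansEvent (d k) (p k) (z k)
                  (c k * BinomialMixture.renyiHalf (d k) (p k) / d k))) ∧
    (∀ (n d : ℕ → ℕ) (p : ℕ → Fin 2 → unitInterval),
        BinomialMixture.Regime n d p →
        (∀ k, (p k 1 : ℝ) ≤ p k 0) →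
        ((fun k => 1 + (p k 0 : ℝ) / |(p k 0 : ℝ) - p k 1| *
            √(d k * (p k 0 : ℝ) * (d k * (p k 0 : ℝ) + Real.log (n k)) * Real.log (n k) / n k))
          =o[atTop] fun k => BinomialMixture.renyiHalf (d k) (p k)) →
        ∃ c : ℕ → ℝ, (∀ k, 0 < c k) ∧ Tendsto c atTop (𝓝 0) ∧
          ∀ᶠ k in atTop,
            1 - 14 * ((n k : ℝ) ^ 2)⁻¹ ≤
              (BinomialMixture.mixtureLaw (n k) (d k) (p k)).real
                (BinomialMixture.momEvent (n k) (d k) (p k)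
                  (c k * BinomialMixture.renyiHalf (d k) (p k) / d k))) := by
  refine ⟨⟨1, one_pos, fun n d p z γ hreg hcount hγ hsep _ hI => ?_⟩,
    BinomialMixture.mom_consistent⟩
  simp only [one_mul] at hsep hI
  exact BinomialMixture.kmeans_consistent n d p z γ hreg hcount hγ hsep hI
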